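/- **Setting.** Let $1<p\le 2$, $1/p+1/q=1$, $X=\ell^p(\mathbb N)$ (real sequences) with $X^*=\ell^q(\mathbb N)$, and let $Y$ be a real Hilbert space. Put $f_p(x)=\frac1p\|x\|^p$ and $J_p(x)=\nabla f_p(x)=(|x_i|^{p-1}\operatorname{sgn}x_i)_i\in\ell^q$, so that $J_q=J_p^{-1}$, and $$D_{f_p}(z,x)=f_p(z)-f_p(x)-\langle J_p(x),z-x\rangle .$$ Let $F:X\to Y$, $y,y^\delta\in Y$, $\delta>0$, $\|y-y^\delta\|\le\delta$, and $\Phi_\alpha(x)=\frac12\|F(x)-y^\delta\|^2+\alpha f_p(x)$. **Standing assumption.** There are numbers $L>0$, $c>0$, $s>2$, $0<\varrho<\frac1{sc}$ such that $F$ is Fréchet differentiable on $X$ and 1. $\|F'(x)-F'(z)\|\le L\|x-z\|$ for all $x,z\in X$; 2. $\|F(x)-F(z)-F'(z)(x-z)\|\le c\,D_{f_p}(x,z)$ for all $x,z\in X$; 3. there are $x^\dagger\in X$ with $F(x^\dagger)=y$ and $f_p(x^\dagger)=\min\{f_p(x):F(x)=y\}$, and $\omega\in Y$ with $\|\omega\|\le\varrho$,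 such that $J_p(x^\dagger)=F'(x^\dagger)^*\omega$. **Constants.** Let $\alpha^*=\frac{\delta}{(s-2)\varrho}$, $\gamma=\frac{1-sc\varrho}2$, $A=\left(\frac p{2\alpha^*}\right)^{1/p}\|F(0)-y^\delta\|^{2/p}$, $K=LA+\|F'(0)\|$ and, for $\alpha\ge\alpha^*$, $$r_\alpha=\frac2{1+\sqrt2}\min\Big\{\frac{\gamma\alpha}{csK},\sqrt{\frac{\gamma\alpha}{10cL}}\Big\},\qquad \bar c_A=\frac{p-1}2(2r_\alpha+A)^{p-2}$$ (the first entry of the minimum is $+\infty$ if $K=0$). Let $\tilde c_p>0$ be any constant with $D_{f_p}(z,x)\le\tilde c_p\|x-z\|^p$ for all $x,z\in X$. **Theorem.** Fix $\alpha_j\ge\alpha^*$ and $d_{\alpha_j}>0$. There is a constant $M_0>0$, depending only on $p,s,\varrho,c,L,\delta,\|F(0)-y^\delta\|,\|F'(0)\|,\alpha_j,d_{\alpha_j}$, such that the following holds for every $M_{\alpha_j}\ge M_0$. Let $x_{\alpha_j}^\delta$ be a global minimizer of $\Phi_{\alpha_j}$, and suppose that $$\{x\in X: D_{f_p}(x_{\alpha_j}^\delta,x)\le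 d_{\alpha_j}\}\subset\{x\in X:\|x-x_{\alpha_j}^\delta\|\le r_{\alpha_j}\}.$$ Let $D_{f_p}(x_{\alpha_j}^\delta,x_0)\le d_{\alpha_j}$ and let $(x_k)_{k\ge0}$ satisfy $$J_p(x_{k+1})=J_p(x_k)-\beta_k\nabla\Phi_{\alpha_j}(x_k),\qquad \beta_k=\min\Big\{\frac{\gamma\,\bar c_k\,\alpha_j}{\|\nabla\Phi_{\alpha_j}(x_k)\|^2},\ \frac1{2M_{\alpha_j}}\Big\},$$ where $$\bar c_k=\min\Big\{1,\ \frac{8\,\bar c_A\,(\Phi_{\alpha_j}(x_k)-\phi_k)}{4K^2+4Ls\varrho\alpha_j+4LKr_{\alpha_j}+L^2r_{\alpha_j}^2+8\alpha_j\tilde c_p\,\bar c_A^{\frac{2-p}2}}\Big\},$$ $$\phi_k=\inf_{t\ge0}\Phi_{\alpha_j}\big(J_q(J_p(x_k)-t\,\nabla\Phi_{\alpha_j}(x_k))\big),$$ and $\bar c_A$ is taken at $\alpha=\alpha_j$; if $\nabla\Phi_{\alpha_j}(x_k)=0$ the iteration stays at $x_{k+1}=x_k$. Then $x_k\to x_{\alpha_j}^\delta$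 in norm as $k\to\infty$. -/

import Mathlib

open Filter Topology
open scoped ENNReal lp RealInnerProductSpace

namespace DualTigra

noncomputable section

/-! ### Duality mappings on sequence spaces

`ℓ^p(ℕ, ℝ)` is Mathlib's space of `p`-summable real sequences.  For conjugate exponents the dual
space of `ℓ^p` is identified with `ℓ^q` through the pairing `⟨ξ, x⟩ = ∑ i, ξ i * x i`. -/

/-- The scalar function `t ↦ |t|^(r-1) sgn t`. -/
def signedPow (r t : ℝ) : ℝ := Real.sign t * |t| ^ (r - 1)

lemma abs_signedPow {r : ℝ} (hr : 1 < r) (t : ℝ) : |signedPow r t| = |t| ^ (r - 1) := by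
  rcases lt_trichotomy t 0 with h | h | h
  · simp [signedPow, Real.sign_of_neg h, abs_of_nonneg (Real.rpow_nonneg (abs_nonneg t) _)]
  · simp [signedPow, h, Real.zero_rpow (by linarith : r - 1 ≠ 0)]
  · simp [signedPow, Real.sign_of_pos h, abs_of_nonneg (Real.rpow_nonneg (abs_nonneg t) _)]

lemma mul_signedPow {r : ℝ} (hr : 1 < r) (t : ℝ) : t * signedPow r t = |t| ^ r := by
  have h1 : t * Real.sign t = |t| := by
    rcases lt_trichotomy t 0 with h | h | h
    · simp [Real.sign_of_neg h, abs_of_neg h]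
    · simp [h]
    · simp [Real.sign_of_pos h, abs_of_pos h]
  rw [signedPow, ← mul_assoc, h1]
  rcases eq_or_ne t 0 with h | h
  · simp [h, Real.zero_rpow (by linarith : r ≠ 0)]
  · nth_rewrite 1 [← Real.rpow_one |t|]
    rw [← Real.rpow_add (abs_pos.2 h)]
    congr 1
    ring

lemma abs_signedPow_rpow {a b : ℝ} (hab : a.HolderConjugate b) (t : ℝ) :
    |signedPow a t| ^ b = |t| ^ a := by
  rw [abs_signedPow hab.lt, ← Real.rpow_mul (abs_nonneg t), hab.sub_one_mul_conj]

lemma signedPow_signedPow {a b : ℝ} (hab : a.HolderConjugate b) (t : ℝ) :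
    signedPow b (signedPow a t) = t := by
  have hsgn : Real.sign (signedPow a t) = Real.sign t := by
    rcases lt_trichotomy t 0 with h | h | h
    · have : signedPow a t < 0 := by
        simpa [signedPow, Real.sign_of_neg h] using Real.rpow_pos_of_pos (abs_pos.2 h.ne) (a - 1)
      rw [Real.sign_of_neg this, Real.sign_of_neg h]
    · simp [signedPow, h]
    · have : 0 < signedPow a t := by
        simpa [signedPow, Real.sign_of_pos h] using Real.rpow_pos_of_pos (abs_pos.2 h.ne') (a - 1)
      rw [Real.sign_of_pos this, Real.sign_of_pos h]
  have hexp : (a - 1) * (b - 1) = 1 := by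
    have := hab.sub_one_mul_conj
    linarith [mul_sub (a - 1) b 1]
  rw [signedPow, hsgn, abs_signedPow hab.lt, ← Real.rpow_mul (abs_nonneg t), hexp, Real.rpow_one]
  rcases lt_trichotomy t 0 with h | h | h
  · simp [Real.sign_of_neg h, abs_of_neg h]
  · simp [h]
  · simp [Real.sign_of_pos h, abs_of_pos h]

variable {p q : ℝ≥0∞}

/-- The (single valued) duality mapping `J_p : ℓ^p → ℓ^q = (ℓ^p)^*`,
`J_p x = (|x_i|^(p-1) sgn x_i)_i`, which is the gradient of `f_p`.
Exchanging the roles of the exponents, `dualityMap hpq.symm` is `J_q : ℓ^q → ℓ^p`. -/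
def dualityMap (hpq : p.toReal.HolderConjugate q.toReal) (x : ℓ^p(ℕ, ℝ)) : ℓ^q(ℕ, ℝ) :=
  ⟨fun i => signedPow p.toReal (x i), memℓp_gen (by
    simpa only [Real.norm_eq_abs, abs_signedPow_rpow hpq] using (lp.memℓp x).summable hpq.pos)⟩

/-- `J_q (J_p x) = x`. -/
lemma dualityMap_dualityMap (hpq : p.toReal.HolderConjugate q.toReal) (x : ℓ^p(ℕ, ℝ)) :
    dualityMap hpq.symm (dualityMap hpq x) = x := by
  ext i
  exact signedPow_signedPow hpq (x i)

/-- The duality product `⟨ξ, x⟩` of `ξ ∈ ℓ^q` and `x ∈ ℓ^p`. -/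
def pairing (ξ : ℓ^q(ℕ, ℝ)) (x : ℓ^p(ℕ, ℝ)) : ℝ := ∑' i, ξ i * x i

/-- The element of `ℓ^q` that represents a continuous linear functional on `ℓ^p`. -/
def rieszSeq [Fact (1 ≤ p)] (hpq : p.toReal.HolderConjugate q.toReal)
    (ξ : StrongDual ℝ ℓ^p(ℕ, ℝ)) : ℓ^q(ℕ, ℝ) :=
  ⟨fun i => ξ (lp.single p i (1 : ℝ)), memℓp_gen' (C := ‖ξ‖ ^ q.toReal) (by
    intro s
    set u : ℕ → ℝ := fun i => ξ (lp.single p i (1 : ℝ)) with hu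
    set S : ℝ := ∑ i ∈ s, ‖u i‖ ^ q.toReal with hS
    have hS0 : 0 ≤ S := Finset.sum_nonneg fun i _ => Real.rpow_nonneg (norm_nonneg _) _
    set x : ℓ^p(ℕ, ℝ) := ∑ i ∈ s, lp.single p i (signedPow q.toReal (u i)) with hx
    have h1 : ξ x = S := by
      rw [hx, map_sum, hS]
      refine Finset.sum_congr rfl fun i _ => ?_
      have : lp.single p i (signedPow q.toReal (u i))
          = signedPow q.toReal (u i) • (lp.single p i (1 : ℝ) : ℓ^p(ℕ, ℝ)) := by
        rw [← lp.single_smul]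
        simp
      rw [this, map_smul, smul_eq_mul, mul_comm, Real.norm_eq_abs]
      exact mul_signedPow hpq.symm.lt (u i)
    have h2 : ‖x‖ ^ p.toReal = S := by
      rw [hx, lp.norm_sum_single hpq.pos, hS]
      refine Finset.sum_congr rfl fun i _ => ?_
      rw [Real.norm_eq_abs, Real.norm_eq_abs]
      exact abs_signedPow_rpow hpq.symm (u i)
    have h3 : S ≤ ‖ξ‖ * ‖x‖ := h1 ▸ (le_abs_self _).trans (ξ.le_opNorm x)
    have h4 : ‖x‖ = S ^ (p.toReal)⁻¹ := by
      rw [← h2, Real.rpow_rpow_inv (norm_nonneg _) hpq.pos.ne']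
    rcases hS0.eq_or_lt with h0 | h0
    · rw [← h0]
      positivity
    · have h5 : S ^ (q.toReal)⁻¹ ≤ ‖ξ‖ := by
        have h6 : S = S ^ (q.toReal)⁻¹ * S ^ (p.toReal)⁻¹ := by
          rw [← Real.rpow_add h0, add_comm, hpq.inv_add_inv_eq_one, Real.rpow_one]
        have h7 : S ^ (q.toReal)⁻¹ * S ^ (p.toReal)⁻¹ ≤ ‖ξ‖ * S ^ (p.toReal)⁻¹ := by
          rw [← h6, ← h4]
          exact h3
        exact le_of_mul_le_mul_right h7 (Real.rpow_pos_of_pos h0 _)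
      calc S = (S ^ (q.toReal)⁻¹) ^ q.toReal := (Real.rpow_inv_rpow hS0 hpq.symm.pos.ne').symm
        _ ≤ ‖ξ‖ ^ q.toReal :=
          Real.rpow_le_rpow (Real.rpow_nonneg hS0 _) h5 hpq.symm.nonneg)⟩

/-- The sequence `rieszSeq hpq ξ` represents `ξ`. -/
lemma pairing_rieszSeq [Fact (1 ≤ p)] (hpq : p.toReal.HolderConjugate q.toReal)
    (ξ : StrongDual ℝ ℓ^p(ℕ, ℝ)) (x : ℓ^p(ℕ, ℝ)) : pairing (rieszSeq hpq ξ) x = ξ x := by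
  have hp : p ≠ ⊤ := by
    rintro rfl
    simpa using hpq.pos
  have h := (lp.hasSum_single hp x).mapL ξ
  rw [← h.tsum_eq]
  refine tsum_congr fun i => ?_
  have : lp.single p i (x i) = x i • (lp.single p i (1 : ℝ) : ℓ^p(ℕ, ℝ)) := by
    rw [← lp.single_smul]
    simp
  rw [this, map_smul, smul_eq_mul, mul_comm]
  rfl

/-! ### Bregman distance and Tikhonov functional -/

/-- `f_p(x) = ‖x‖^p / p`. -/
def penalty (x : ℓ^p(ℕ, ℝ)) : ℝ := ‖x‖ ^ p.toReal / p.toReal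

/-- The Bregman distance `D_{f_p}(z, x) = f_p(z) - f_p(x) - ⟨∇f_p(x), z - x⟩`. -/
def bregman (hpq : p.toReal.HolderConjugate q.toReal) (z x : ℓ^p(ℕ, ℝ)) : ℝ :=
  penalty z - penalty x - pairing (dualityMap hpq x) (z - x)

/-- The Bregman ball of radius `d` around `z`. -/
def bregmanBall (hpq : p.toReal.HolderConjugate q.toReal) (z : ℓ^p(ℕ, ℝ)) (d : ℝ) :
    Set ℓ^p(ℕ, ℝ) :=
  {x | bregman hpq z x ≤ d}

variable {Y : Type*} [NormedAddCommGroup Y] [InnerProductSpace ℝ Y]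

/-- The Tikhonov functional `Φ_α(x) = ‖F(x) - y^δ‖² / 2 + (α / p) ‖x‖^p`. -/
def tikhonov (F : ℓ^p(ℕ, ℝ) → Y) (yδ : Y) (α : ℝ) (x : ℓ^p(ℕ, ℝ)) : ℝ :=
  ‖F x - yδ‖ ^ 2 / 2 + α * penalty x

/-- The gradient `∇Φ_α(x)`: the Fréchet derivative of `Φ_α` at `x` as an element of `ℓ^q`. -/
def gradTikhonov [Fact (1 ≤ p)] (hpq : p.toReal.HolderConjugate q.toReal)
    (F : ℓ^p(ℕ, ℝ) → Y) (yδ : Y) (α : ℝ) (x : ℓ^p(ℕ, ℝ)) : ℓ^q(ℕ, ℝ) :=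
  rieszSeq hpq (fderiv ℝ (tikhonov F yδ α) x)

/-! ### Constants -/

/-- The numbers on which the constants of the method depend: the exponent `p`, the parameters
`s`, `ϱ`, `c`, `L` of the standing assumption, the noise level `δ`, and the values
`res₀ = ‖F(0) - y^δ‖`, `der₀ = ‖F'(0)‖`. -/
structure Constants where
  p : ℝ
  s : ℝ
  ϱ : ℝ
  c : ℝ
  L : ℝ
  δ : ℝ
  res₀ : ℝ
  der₀ : ℝ

namespace Constants

/-- The sign and smallness conditions on the parameters. -/
structure Admissible (C : Constants) : Prop where
  two_lt_s : 2 < C.s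
  ϱ_pos : 0 < C.ϱ
  c_pos : 0 < C.c
  L_pos : 0 < C.L
  δ_pos : 0 < C.δ
  ϱ_lt : C.ϱ < 1 / (C.s * C.c)

variable (C : Constants) (α : ℝ)

/-- `α^* = δ / ((s - 2) ϱ)`. -/
def alphaStar : ℝ := C.δ / ((C.s - 2) * C.ϱ)

/-- `A = (p / (2 α^*))^(1/p) ‖F(0) - y^δ‖^(2/p)`. -/
def A : ℝ := (C.p / (2 * C.alphaStar)) ^ (1 / C.p) * C.res₀ ^ (2 / C.p)

/-- `K = L A + ‖F'(0)‖`. -/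
def K : ℝ := C.L * C.A + C.der₀

/-- `γ = (1 - s c ϱ) / 2`. -/
def γ : ℝ := (1 - C.s * C.c * C.ϱ) / 2

/-- `r_α = 2 / (1 + √2) * min {γ α / (c s K), √(γ α / (10 c L))}`; if `K = 0` the first entry of
the minimum is `+∞`. -/
def r : ℝ :=
  2 / (1 + √2) *
    if C.K = 0 then √(C.γ * α / (10 * C.c * C.L))
    else min (C.γ * α / (C.c * C.s * C.K)) √(C.γ * α / (10 * C.c * C.L))

/-- `c̄_A = (p - 1) / 2 * (2 r_α + A)^(p - 2)`. -/
def cBarA : ℝ := (C.p - 1) / 2 * (2 * C.r α + C.A) ^ (C.p - 2)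

/-- `c̄ = min {1, 8 c̄_A g / (4 K² + 4 L s ϱ α + 4 L K r_α + L² r_α² + 8 α c̃_p c̄_A^((2-p)/2))}`,
where `g` stands for the difference `Φ_α(x) - φ`. -/
def cBar (cp g : ℝ) : ℝ :=
  min 1 (8 * C.cBarA α * g /
    (4 * C.K ^ 2 + 4 * C.L * C.s * C.ϱ * α + 4 * C.L * C.K * C.r α + C.L ^ 2 * C.r α ^ 2
      + 8 * α * cp * C.cBarA α ^ ((2 - C.p) / 2)))

end Constants

/-! ### The standing assumption and the step sizes -/

/-- `c̃` is an admissible constant in the estimate `D_{f_p}(z, x) ≤ c̃ ‖x - z‖^p`. -/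
def IsSmoothnessConstant (hpq : p.toReal.HolderConjugate q.toReal) (cp : ℝ) : Prop :=
  0 < cp ∧ ∀ x z : ℓ^p(ℕ, ℝ), bregman hpq z x ≤ cp * ‖x - z‖ ^ p.toReal

/-- `x†` is an `f_p`-minimizing solution of `F(x) = y`. -/
def IsPenaltyMinimizingSolution (F : ℓ^p(ℕ, ℝ) → Y) (y : Y) (x : ℓ^p(ℕ, ℝ)) : Prop :=
  F x = y ∧ ∀ z, F z = y → penalty x ≤ penalty z

/-- The standing assumption on the operator `F` and the exact data `y`: differentiability,
Lipschitz continuity of the derivative, the nonlinearity condition, and the source condition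
`J_p(x†) = F'(x†)^* ω` with `‖ω‖ ≤ ϱ`. -/
structure StandingAssumption [Fact (1 ≤ p)] (hpq : p.toReal.HolderConjugate q.toReal)
    (C : Constants) (F : ℓ^p(ℕ, ℝ) → Y) (y : Y) : Prop where
  differentiable : Differentiable ℝ F
  lipschitz : ∀ x z, ‖fderiv ℝ F x - fderiv ℝ F z‖ ≤ C.L * ‖x - z‖
  nonlinearity : ∀ x z, ‖F x - F z - fderiv ℝ F z (x - z)‖ ≤ C.c * bregman hpq x z
  source : ∃ (xd : ℓ^p(ℕ, ℝ)) (ω : Y), IsPenaltyMinimizingSolution F y xd ∧ ‖ω‖ ≤ C.ϱ ∧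
    ∀ h, pairing (dualityMap hpq xd) h = ⟪ω, fderiv ℝ F xd h⟫

section StepSize

variable [Fact (1 ≤ p)] (hpq : p.toReal.HolderConjugate q.toReal)

/-- `φ = min {Φ_α(J_q(J_p(x) - t ∇Φ_α(x))) : t ≥ 0}`, the best value of `Φ_α` along the dual
gradient descent curve through `x`. -/
def lineMin (F : ℓ^p(ℕ, ℝ) → Y) (yδ : Y) (α : ℝ) (x : ℓ^p(ℕ, ℝ)) : ℝ :=
  sInf ((fun t : ℝ => tikhonov F yδ α
    (dualityMap hpq.symm (dualityMap hpq x - t • gradTikhonov hpq F yδ α x))) '' Set.Ici 0)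

/-- The step size `β = min {γ c̄ α / ‖∇Φ_α(x)‖², 1 / (2 M)}` at the iterate `x`. -/
def stepSize (C : Constants) (F : ℓ^p(ℕ, ℝ) → Y) (yδ : Y) (α cp M : ℝ) (x : ℓ^p(ℕ, ℝ)) : ℝ :=
  min (C.γ * C.cBar α cp (tikhonov F yδ α x - lineMin hpq F yδ α x) * α /
      ‖gradTikhonov hpq F yδ α x‖ ^ 2)
    (1 / (2 * M))

/-- The dual gradient descent iteration
`J_p(x_{k+1}) = J_p(x_k) - β_k ∇Φ_α(x_k)`, `x_{k+1} = J_q(J_p(x_{k+1}))`. -/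
def IsDualGradientSequence (C : Constants) (F : ℓ^p(ℕ, ℝ) → Y) (yδ : Y) (α cp M : ℝ)
    (x : ℕ → ℓ^p(ℕ, ℝ)) : Prop :=
  ∀ k, dualityMap hpq (x (k + 1)) =
    dualityMap hpq (x k) -
      stepSize hpq C F yδ α cp M (x k) • gradTikhonov hpq F yδ α (x k)

end StepSize

end

end DualTigra

open DualTigra

/-! The iteration is mirror descent with mirror map `J_p`, and `D(x_α, x_k)`, with `x_α` the
minimizer, is its Lyapunov function. Two estimates relative to the Bregman distance drive the proof.

Star-convexity (`bregman_le_pairing_grad`): near `x_α`, `⟨∇Φ(x), x - x_α⟩ ≥ γ α D(x_α, x) + Φ(x) -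
Φ(x_α)`. The linearization error of `F` costs at most `c ‖F x - yδ‖ D(x_α, x)`. The source condition
makes the residual at `x_α` at most `s ϱ α` (`norm_residual_minimizer_le`), and `s c ϱ < 1`, so the
penalty term `α D` wins.

Relative smoothness (`tikhonov_le_of_lipschitz`): on bounded sets the first order remainder of `Φ`
is at most `Λ D`. Its quadratic part is controlled because, for `p ≤ 2`, `D` dominates `κ ‖z - x‖²`
there (`exists_mul_sq_norm_sub_le_bregman`).

By the three point identity, `D(x_α, x_{k+1}) = D(x_α, x_k) + D(x_k, x_{k+1}) - β_k ⟨∇Φ(x_k), x_k -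
x_α⟩`. For `β_k Λ ≤ 1`, smoothness bounds the middle term by `β_k (Φ(x_k) - Φ(x_α))`, which
star-convexity cancels, leaving `D(x_α, x_{k+1}) ≤ (1 - γ α β_k) D(x_α, x_k)`. The iterates
therefore stay in the Bregman ball.

It remains to exclude vanishing steps. While `D(x_α, x_k) ≥ ε`, a fixed trial step already lowers
`Φ` by a definite amount, so `Φ(x_k) - φ_k`, and with it `β_k`, is bounded below. Hence `D(x_α, x_k)
→ 0`, and `κ ‖x_k - x_α‖² ≤ D(x_α, x_k)` gives norm convergence. -/

namespace DualTigra

/-! ### The scalar Bregman distance -/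

lemma signedPow_of_nonneg {r t : ℝ} (hr : 1 < r) (ht : 0 ≤ t) : signedPow r t = t ^ (r - 1) := by
  rcases ht.eq_or_lt with h | h
  · simp [signedPow, ← h, Real.zero_rpow (by linarith : r - 1 ≠ 0)]
  · simp [signedPow, Real.sign_of_pos h, abs_of_pos h]

lemma signedPow_neg (r t : ℝ) : signedPow r (-t) = -signedPow r t := by
  simp [signedPow, Real.sign_neg]

lemma hasDerivAt_abs_rpow_div {r : ℝ} (hr : 1 < r) (t : ℝ) :
    HasDerivAt (fun s : ℝ => |s| ^ r / r) (signedPow r t) t := by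
  have h := (hasDerivAt_abs_rpow t hr).div_const r
  refine h.congr_deriv ?_
  have hr0 : r ≠ 0 := by linarith
  rw [mul_assoc, mul_div_cancel_left₀ _ hr0]
  rcases eq_or_ne t 0 with rfl | ht
  · simp [signedPow]
  · have h1 : |t| ^ (r - 1) = |t| ^ (r - 2) * |t| := by
      rw [← Real.rpow_add_one (abs_pos.2 ht).ne']
      congr 1
      ring
    rw [signedPow, h1]
    rcases lt_or_gt_of_ne ht with h | h
    · rw [Real.sign_of_neg h, abs_of_neg h]; ring
    · rw [Real.sign_of_pos h, abs_of_pos h]; ring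

/-- Since `r ≤ 2`, the derivative `(r - 1) u ^ (r - 2)` is nonincreasing in `u > 0`, so on `(0, m)`
it is at least its value at `m`. -/
lemma rpow_sub_one_sub_ge {r m s t : ℝ} (hr : 1 < r) (hr2 : r ≤ 2) (hs : 0 ≤ s) (hst : s ≤ t)
    (htm : t ≤ m) : (r - 1) * m ^ (r - 2) * (t - s) ≤ t ^ (r - 1) - s ^ (r - 1) := by
  have hmono : MonotoneOn (fun u : ℝ => u ^ (r - 1) - (r - 1) * m ^ (r - 2) * u)
      (Set.Icc 0 m) := by
    have hd : ∀ u ∈ Set.Ioo (0 : ℝ) m, HasDerivAt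
        (fun u : ℝ => u ^ (r - 1) - (r - 1) * m ^ (r - 2) * u)
        ((r - 1) * u ^ (r - 1 - 1) - (r - 1) * m ^ (r - 2) * 1) u := fun u hu =>
      (Real.hasDerivAt_rpow_const (Or.inl hu.1.ne')).sub ((hasDerivAt_id u).const_mul _)
    refine monotoneOn_of_deriv_nonneg (convex_Icc 0 m) ?_ ?_ ?_
    · exact ((Real.continuous_rpow_const (by linarith)).sub
        (continuous_const.mul continuous_id)).continuousOn
    · intro u hu
      rw [interior_Icc] at hu
      exact (hd u hu).differentiableAt.differentiableWithinAt
    · intro u hu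
      rw [interior_Icc] at hu
      rw [(hd u hu).deriv]
      have h1 : m ^ (r - 2) ≤ u ^ (r - 2) :=
        Real.rpow_le_rpow_of_nonpos hu.1 hu.2.le (by linarith)
      have h2 : r - 1 - 1 = r - 2 := by ring
      rw [h2]
      nlinarith
  have h := hmono ⟨hs, hst.trans htm⟩ ⟨hs.trans hst, htm⟩ hst
  simp only at h
  linarith [mul_sub ((r - 1) * m ^ (r - 2)) t s]

lemma signedPow_sub_ge {r m s t : ℝ} (hr : 1 < r) (hr2 : r ≤ 2) (hs : -m ≤ s) (hst : s ≤ t)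
    (htm : t ≤ m) :
    (r - 1) * m ^ (r - 2) * (t - s) ≤ signedPow r t - signedPow r s := by
  have key : ∀ {s t : ℝ}, 0 ≤ s → s ≤ t → t ≤ m →
      (r - 1) * m ^ (r - 2) * (t - s) ≤ signedPow r t - signedPow r s := by
    intro s t hs hst htm
    rw [signedPow_of_nonneg hr hs, signedPow_of_nonneg hr (hs.trans hst)]
    exact rpow_sub_one_sub_ge hr hr2 hs hst htm
  have hz : signedPow r 0 = 0 := by simp [signedPow]
  rcases le_total 0 s with h0 | h0
  · exact key h0 hst htm
  · rcases le_total 0 t with h1 | h1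
    · have e1 := key le_rfl h1 htm
      have e2 := key le_rfl (neg_nonneg.2 h0) (by linarith)
      rw [signedPow_neg] at e2
      rw [hz] at e1 e2
      linarith [mul_sub ((r - 1) * m ^ (r - 2)) t s, mul_sub ((r - 1) * m ^ (r - 2)) t 0,
        mul_sub ((r - 1) * m ^ (r - 2)) (-s) 0, mul_neg ((r - 1) * m ^ (r - 2)) s]
    · have e := key (neg_nonneg.2 h1) (neg_le_neg hst) (by linarith)
      rw [signedPow_neg, signedPow_neg] at e
      have : -s - -t = t - s := by ring
      rw [this] at e
      linarith

/-- The scalar Bregman distance of `|t|^r / r`, `1 < r ≤ 2`, dominates a weighted square. -/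
lemma scalar_bregman_ge {r : ℝ} (hr : 1 < r) (hr2 : r ≤ 2) (a b : ℝ) :
    (r - 1) / 2 * (|a| + |b|) ^ (r - 2) * (a - b) ^ 2
      ≤ |a| ^ r / r - |b| ^ r / r - signedPow r b * (a - b) := by
  set m := |a| + |b| with hm
  set k := (r - 1) * m ^ (r - 2) with hk
  have ha : |a| ≤ m := by linarith [abs_nonneg b]
  have hb : |b| ≤ m := by linarith [abs_nonneg a]
  rw [abs_le] at ha hb
  -- The derivative of `ψ` is monotone on `[-m, m]`, an interval containing `a` and `b`. The claim
  -- is the tangent inequality at `b` for this convex function.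
  set ψ : ℝ → ℝ := fun s => |s| ^ r / r - k / 2 * s ^ 2 with hψ
  have hd : ∀ t, HasDerivAt ψ (signedPow r t - k * t) t := by
    intro t
    have := (hasDerivAt_abs_rpow_div hr t).sub ((hasDerivAt_pow 2 t).const_mul (k / 2))
    refine this.congr_deriv ?_
    norm_num
    ring
  have hc : Continuous ψ := continuous_iff_continuousAt.2 fun t => (hd t).continuousAt
  have hmono : ∀ {s t}, -m ≤ s → s ≤ t → t ≤ m →
      signedPow r s - k * s ≤ signedPow r t - k * t := by
    intro s t h1 h2 h3
    have := signedPow_sub_ge hr hr2 h1 h2 h3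
    linarith [mul_sub k t s]
  suffices h : (signedPow r b - k * b) * (a - b) ≤ ψ a - ψ b by
    simp only [hψ] at h
    have : (r - 1) / 2 * m ^ (r - 2) = k / 2 := by rw [hk]; ring
    rw [this]
    nlinarith [h]
  rcases lt_trichotomy a b with h | h | h
  · obtain ⟨c, hc1, hc2⟩ := exists_hasDerivAt_eq_slope ψ _ h hc.continuousOn fun t _ => hd t
    rw [eq_div_iff (by linarith)] at hc2
    have := hmono (by linarith [hc1.1]) hc1.2.le hb.2
    nlinarith [mul_le_mul_of_nonneg_right this (by linarith : 0 ≤ b - a)]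
  · simp [h]
  · obtain ⟨c, hc1, hc2⟩ := exists_hasDerivAt_eq_slope ψ _ h hc.continuousOn fun t _ => hd t
    rw [eq_div_iff (by linarith)] at hc2
    have := hmono hb.1 hc1.1.le (by linarith [hc1.2])
    nlinarith [mul_le_mul_of_nonneg_right this (by linarith : 0 ≤ a - b)]

lemma add_rpow_le_two_rpow_mul {r a b : ℝ} (hr : 0 ≤ r) (ha : 0 ≤ a) (hb : 0 ≤ b) :
    (a + b) ^ r ≤ 2 ^ r * (a ^ r + b ^ r) := by
  have h1 : a + b ≤ 2 * max a b := by
    linarith [le_max_left a b, le_max_right a b]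
  have h2 : (a + b) ^ r ≤ (2 * max a b) ^ r := Real.rpow_le_rpow (by positivity) h1 hr
  rw [Real.mul_rpow (by norm_num) (le_max_of_le_left ha)] at h2
  refine h2.trans (mul_le_mul_of_nonneg_left ?_ (by positivity))
  have := Real.rpow_nonneg ha r
  have := Real.rpow_nonneg hb r
  rcases max_choice a b with h | h <;> rw [h] <;> linarith

/-! ### The pairing and the duality mapping -/

section Duality

variable {p q : ℝ≥0∞}

lemma summable_pairing (hpq : p.toReal.HolderConjugate q.toReal) (ξ : ℓ^q(ℕ, ℝ))
    (x : ℓ^p(ℕ, ℝ)) : Summable fun i => ξ i * x i := by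
  refine Summable.of_norm ?_
  simpa only [norm_mul] using lp.summable_mul hpq.symm ξ x

lemma abs_pairing_le (hpq : p.toReal.HolderConjugate q.toReal) (ξ : ℓ^q(ℕ, ℝ))
    (x : ℓ^p(ℕ, ℝ)) : |pairing ξ x| ≤ ‖ξ‖ * ‖x‖ := by
  have h1 := norm_tsum_le_tsum_norm (summable_pairing hpq ξ x).norm
  simp only [norm_mul, Real.norm_eq_abs] at h1
  have h2 := lp.tsum_mul_le_mul_norm' hpq.symm ξ x
  simp only [Real.norm_eq_abs] at h2
  exact h1.trans h2

lemma pairing_sub_left (hpq : p.toReal.HolderConjugate q.toReal) (ξ η : ℓ^q(ℕ, ℝ))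
    (x : ℓ^p(ℕ, ℝ)) : pairing (ξ - η) x = pairing ξ x - pairing η x := by
  rw [pairing, pairing, pairing,
    ← (summable_pairing hpq ξ x).tsum_sub (summable_pairing hpq η x)]
  refine tsum_congr fun i => ?_
  rw [lp.coeFn_sub, Pi.sub_apply, sub_mul]

lemma pairing_smul_left (t : ℝ) (ξ : ℓ^q(ℕ, ℝ)) (x : ℓ^p(ℕ, ℝ)) :
    pairing (t • ξ) x = t * pairing ξ x := by
  rw [pairing, pairing, ← tsum_mul_left]
  refine tsum_congr fun i => ?_
  rw [lp.coeFn_smul, Pi.smul_apply, smul_eq_mul, mul_assoc]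

lemma pairing_add_right (hpq : p.toReal.HolderConjugate q.toReal) (ξ : ℓ^q(ℕ, ℝ))
    (x z : ℓ^p(ℕ, ℝ)) : pairing ξ (x + z) = pairing ξ x + pairing ξ z := by
  rw [pairing, pairing, pairing,
    ← (summable_pairing hpq ξ x).tsum_add (summable_pairing hpq ξ z)]
  refine tsum_congr fun i => ?_
  rw [lp.coeFn_add, Pi.add_apply, mul_add]

lemma pairing_smul_right (t : ℝ) (ξ : ℓ^q(ℕ, ℝ)) (x : ℓ^p(ℕ, ℝ)) :
    pairing ξ (t • x) = t * pairing ξ x := by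
  rw [pairing, pairing, ← tsum_mul_left]
  refine tsum_congr fun i => ?_
  rw [lp.coeFn_smul, Pi.smul_apply, smul_eq_mul]
  ring

lemma pairing_sub_right (hpq : p.toReal.HolderConjugate q.toReal) (ξ : ℓ^q(ℕ, ℝ))
    (x z : ℓ^p(ℕ, ℝ)) : pairing ξ (x - z) = pairing ξ x - pairing ξ z := by
  have h := pairing_add_right hpq ξ (x - z) z
  rw [sub_add_cancel] at h
  linarith

/-- The continuous linear functional on `ℓ^p` represented by an element of `ℓ^q`. -/
noncomputable def pairingCLM [Fact (1 ≤ p)] (hpq : p.toReal.HolderConjugate q.toReal)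
    (ξ : ℓ^q(ℕ, ℝ)) : StrongDual ℝ ℓ^p(ℕ, ℝ) :=
  LinearMap.mkContinuous
    { toFun := fun x => pairing ξ x
      map_add' := pairing_add_right hpq ξ
      map_smul' := fun t x => pairing_smul_right t ξ x } ‖ξ‖ (abs_pairing_le hpq ξ)

lemma dualityMap_apply (hpq : p.toReal.HolderConjugate q.toReal) (x : ℓ^p(ℕ, ℝ)) (i : ℕ) :
    dualityMap hpq x i = signedPow p.toReal (x i) := rfl

lemma pairing_dualityMap_self (hpq : p.toReal.HolderConjugate q.toReal) (x : ℓ^p(ℕ, ℝ)) :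
    pairing (dualityMap hpq x) x = ‖x‖ ^ p.toReal := by
  rw [lp.norm_rpow_eq_tsum hpq.pos, pairing]
  refine tsum_congr fun i => ?_
  rw [dualityMap_apply, mul_comm, mul_signedPow hpq.lt, Real.norm_eq_abs]

lemma pairing_comm (ξ : ℓ^q(ℕ, ℝ)) (x : ℓ^p(ℕ, ℝ)) : pairing ξ x = pairing x ξ :=
  tsum_congr fun _ => mul_comm _ _

lemma norm_dualityMap (hpq : p.toReal.HolderConjugate q.toReal) (x : ℓ^p(ℕ, ℝ)) :
    ‖dualityMap hpq x‖ = ‖x‖ ^ (p.toReal - 1) := by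
  have h : ‖dualityMap hpq x‖ ^ q.toReal = ‖x‖ ^ p.toReal := by
    rw [lp.norm_rpow_eq_tsum hpq.pos, lp.norm_rpow_eq_tsum hpq.symm.pos]
    refine tsum_congr fun i => ?_
    rw [dualityMap_apply, Real.norm_eq_abs, Real.norm_eq_abs, abs_signedPow_rpow hpq]
  rw [← hpq.sub_one_mul_conj, Real.rpow_mul (lp.norm_nonneg' _)] at h
  exact (Real.rpow_left_inj (lp.norm_nonneg' _) (Real.rpow_nonneg (lp.norm_nonneg' _) _)
    hpq.symm.pos.ne').1 h

/-- Testing `ξ` on `J_q u` gives `‖u‖ ^ q`, while `‖J_q u‖ = ‖u‖ ^ (q - 1)`. -/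
lemma norm_rieszSeq_le [Fact (1 ≤ p)] (hpq : p.toReal.HolderConjugate q.toReal)
    (ξ : StrongDual ℝ ℓ^p(ℕ, ℝ)) : ‖rieszSeq hpq ξ‖ ≤ ‖ξ‖ := by
  set u := rieszSeq hpq ξ with hu
  have h1 : ‖u‖ ^ q.toReal = ξ (dualityMap hpq.symm u) := by
    rw [← pairing_dualityMap_self hpq.symm, ← pairing_rieszSeq hpq, pairing_comm]
  have h2 := (le_abs_self _).trans (ξ.le_opNorm (dualityMap hpq.symm u))
  rw [← h1, norm_dualityMap hpq.symm] at h2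
  rcases (lp.norm_nonneg' u).eq_or_lt with h | h
  · rw [← h]; positivity
  · have h3 : ‖u‖ ^ q.toReal = ‖u‖ * ‖u‖ ^ (q.toReal - 1) := by
      rw [mul_comm, ← Real.rpow_add_one h.ne', sub_add_cancel]
    rw [h3] at h2
    exact le_of_mul_le_mul_right h2 (Real.rpow_pos_of_pos h _)

/-! ### The Bregman distance -/

/-- The Bregman distance splits over coordinates, which transfers the scalar estimates to the
sequence space. -/
lemma hasSum_bregman (hpq : p.toReal.HolderConjugate q.toReal) (z x : ℓ^p(ℕ, ℝ)) :
    HasSum (fun i => |z i| ^ p.toReal / p.toReal - |x i| ^ p.toReal / p.toReal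
      - signedPow p.toReal (x i) * (z i - x i)) (bregman hpq z x) := by
  have h1 := (lp.hasSum_norm hpq.pos z).div_const p.toReal
  have h2 := (lp.hasSum_norm hpq.pos x).div_const p.toReal
  have h3 := (summable_pairing hpq (dualityMap hpq x) (z - x)).hasSum
  exact (h1.sub h2).sub h3

lemma bregman_nonneg (hpq : p.toReal.HolderConjugate q.toReal) (hp2 : p.toReal ≤ 2)
    (z x : ℓ^p(ℕ, ℝ)) : 0 ≤ bregman hpq z x := by
  refine (hasSum_bregman hpq z x).nonneg fun i => le_trans ?_
    (scalar_bregman_ge hpq.lt hp2 (z i) (x i))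
  have := hpq.lt
  have : 0 ≤ (p.toReal - 1) / 2 := by linarith
  positivity

/-- The three point identity. -/
lemma bregman_three_point (hpq : p.toReal.HolderConjugate q.toReal) (z x x' : ℓ^p(ℕ, ℝ)) :
    bregman hpq z x' = bregman hpq z x + bregman hpq x x'
      + pairing (dualityMap hpq x - dualityMap hpq x') (z - x) := by
  simp only [bregman, pairing_sub_left hpq, pairing_sub_right hpq]
  ring

lemma bregman_self (hpq : p.toReal.HolderConjugate q.toReal) (x : ℓ^p(ℕ, ℝ)) :
    bregman hpq x x = 0 := by
  simp [bregman, pairing]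

lemma bregman_add_bregman (hpq : p.toReal.HolderConjugate q.toReal) (x x' : ℓ^p(ℕ, ℝ)) :
    bregman hpq x x' + bregman hpq x' x
      = pairing (dualityMap hpq x - dualityMap hpq x') (x - x') := by
  have := bregman_three_point hpq x' x x'
  simp only [bregman_self, pairing_sub_right hpq] at this ⊢
  linarith

/-- On bounded sets the Bregman distance of `f_p`, `1 < p ≤ 2`, dominates the squared norm. -/
lemma exists_mul_sq_norm_sub_le_bregman [Fact (1 ≤ p)] (hpq : p.toReal.HolderConjugate q.toReal)
    (hp2 : p.toReal ≤ 2) (R : ℝ) :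
    ∃ κ : ℝ, 0 < κ ∧ ∀ z x : ℓ^p(ℕ, ℝ), ‖z‖ ≤ R → ‖x‖ ≤ R →
      κ * ‖z - x‖ ^ 2 ≤ bregman hpq z x := by
  set r := p.toReal with hr
  have hr1 : 1 < r := hpq.lt
  have hr0 : 0 < r := hpq.pos
  rcases lt_or_ge R 0 with hR | hR
  · exact ⟨1, one_pos, fun z x hz _ => absurd ((norm_nonneg z).trans hz) (not_le.2 hR)⟩
  -- `W` bounds `∑ (|z i| + |x i|) ^ r`; the summand `1` keeps it positive when `R = 0`. `V` is the
  -- resulting first factor in Hölder's inequality.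
  set W : ℝ := 2 ^ r * (R ^ r + R ^ r) + 1 with hW
  have hW0 : 0 < W := by positivity
  set V : ℝ := W ^ (1 - r / 2) with hV
  have hV0 : 0 < V := by positivity
  refine ⟨(r - 1) / 2 / V ^ (2 / r), by have : 0 < r - 1 := by linarith
                                        positivity, fun z x hz hx => ?_⟩
  set D := bregman hpq z x with hD
  have hD0 : 0 ≤ D := bregman_nonneg hpq hp2 z x
  set S := 2 / (r - 1) * D with hS
  have hS0 : 0 ≤ S := mul_nonneg (div_nonneg (by norm_num) (by linarith)) hD0
  have hsum : ∀ s : Finset ℕ, ∑ i ∈ s, |z i - x i| ^ r ≤ V * S ^ (r / 2) := by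
    intro s
    have hw : ∀ i, 0 ≤ |z i| + |x i| := fun i => by positivity
    -- Weighted Hölder with exponent `2 / r`: weight times function is `|z i - x i| ^ r`, and weight
    -- times the `2 / r`-th power of the function is the weighted square in `scalar_bregman_ge`.
    -- Coordinates with `z i = x i = 0` contribute zero on both sides.
    have hin := Real.inner_le_weight_mul_Lp_of_nonneg s (p := 2 / r)
      (by rw [le_div_iff₀ hr0]; linarith) (fun i => (|z i| + |x i|) ^ r)
      (fun i => (|z i - x i| / (|z i| + |x i|)) ^ r) (fun i => by positivity)
      (fun i => by positivity)
    have e1 : ∀ i, (|z i| + |x i|) ^ r * (|z i - x i| / (|z i| + |x i|)) ^ r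
        = |z i - x i| ^ r := by
      intro i
      rw [← Real.mul_rpow (hw i) (by positivity)]
      congr 1
      rcases (hw i).eq_or_lt with h | h
      · have : |z i - x i| ≤ |z i| + |x i| := abs_sub _ _
        have : |z i - x i| = 0 := le_antisymm (by linarith) (abs_nonneg _)
        rw [this, ← h]; simp
      · field_simp
    have e2 : ∀ i, (|z i| + |x i|) ^ r * ((|z i - x i| / (|z i| + |x i|)) ^ r) ^ (2 / r)
        = (|z i| + |x i|) ^ (r - 2) * (z i - x i) ^ 2 := by
      intro i
      rw [← Real.rpow_mul (by positivity), mul_div_cancel₀ _ hr0.ne', Real.rpow_two, div_pow,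
        sq_abs]
      rcases (hw i).eq_or_lt with h | h
      · have : |z i - x i| ≤ |z i| + |x i| := abs_sub _ _
        have : z i - x i = 0 := abs_eq_zero.1 (le_antisymm (by linarith) (abs_nonneg _))
        rw [this]; simp
      · rw [Real.rpow_sub h, Real.rpow_two]; ring
    simp only [e1, e2, inv_div] at hin
    refine hin.trans (mul_le_mul ?_ ?_ (by positivity) hV0.le)
    · refine Real.rpow_le_rpow (Finset.sum_nonneg fun i _ => by positivity) ?_ (by linarith)
      calc ∑ i ∈ s, (|z i| + |x i|) ^ r
          ≤ ∑ i ∈ s, 2 ^ r * (|z i| ^ r + |x i| ^ r) := Finset.sum_le_sum fun i _ =>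
            add_rpow_le_two_rpow_mul hr0.le (abs_nonneg _) (abs_nonneg _)
        _ = 2 ^ r * (∑ i ∈ s, ‖z i‖ ^ r + ∑ i ∈ s, ‖x i‖ ^ r) := by
            rw [← Finset.mul_sum, Finset.sum_add_distrib]; rfl
        _ ≤ 2 ^ r * (R ^ r + R ^ r) := by
            refine mul_le_mul_of_nonneg_left (add_le_add ?_ ?_) (by positivity)
            · exact (lp.sum_rpow_le_norm_rpow hr0 z s).trans
                (Real.rpow_le_rpow (norm_nonneg _) hz hr0.le)
            · exact (lp.sum_rpow_le_norm_rpow hr0 x s).trans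
                (Real.rpow_le_rpow (norm_nonneg _) hx hr0.le)
        _ ≤ W := by linarith
    · refine Real.rpow_le_rpow (Finset.sum_nonneg fun i _ => by positivity) ?_ (by positivity)
      have hb := sum_le_hasSum s (fun i _ => le_trans (by
        have : 0 ≤ (r - 1) / 2 := by linarith
        positivity) (scalar_bregman_ge hr1 hp2 (z i) (x i))) (hasSum_bregman hpq z x)
      have hc := (Finset.sum_le_sum fun i (_ : i ∈ s) =>
        scalar_bregman_ge hr1 hp2 (z i) (x i)).trans hb
      simp only [mul_assoc] at hc
      rw [← Finset.mul_sum] at hc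
      rw [hS, div_mul_eq_mul_div, le_div_iff₀ (by linarith)]
      linarith
  have hn : ‖z - x‖ ^ r ≤ V * S ^ (r / 2) := by
    rw [lp.norm_rpow_eq_tsum hr0]
    exact ((lp.memℓp (z - x)).summable hr0).tsum_le_of_sum_le hsum
  have hn2 : ‖z - x‖ ^ 2 ≤ V ^ (2 / r) * S := by
    have := Real.rpow_le_rpow (by positivity) hn (by positivity : 0 ≤ 2 / r)
    rwa [← Real.rpow_mul (norm_nonneg _), mul_div_cancel₀ _ hr0.ne', Real.rpow_two,
      Real.mul_rpow hV0.le (by positivity), ← Real.rpow_mul hS0,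
      show r / 2 * (2 / r) = 1 by field_simp, Real.rpow_one] at this
  calc (r - 1) / 2 / V ^ (2 / r) * ‖z - x‖ ^ 2
      ≤ (r - 1) / 2 / V ^ (2 / r) * (V ^ (2 / r) * S) :=
        mul_le_mul_of_nonneg_left hn2 (div_nonneg (by linarith) (by positivity))
    _ = D := by
        have : V ^ (2 / r) ≠ 0 := by positivity
        have : r - 1 ≠ 0 := by linarith
        rw [hS]; field_simp

end Duality

/-! ### The gradient of the Tikhonov functional -/

section Tikhonov

variable {p q : ℝ≥0∞} {Y : Type*} [NormedAddCommGroup Y] [InnerProductSpace ℝ Y]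

section Gradient

variable [Fact (1 ≤ p)] (hpq : p.toReal.HolderConjugate q.toReal)

/-- The first order remainder is the Bregman distance itself, which lies between `0` and `cp ‖x - z‖
^ p` with `p > 1`. -/
lemma hasFDerivAt_penalty (hp2 : p.toReal ≤ 2) {cp : ℝ} (hcp : IsSmoothnessConstant hpq cp)
    (x : ℓ^p(ℕ, ℝ)) :
    HasFDerivAt (penalty : ℓ^p(ℕ, ℝ) → ℝ) (pairingCLM hpq (dualityMap hpq x)) x := by
  rw [hasFDerivAt_iff_isLittleO]
  have h1 : (fun z : ℓ^p(ℕ, ℝ) => penalty z - penalty x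
      - pairingCLM hpq (dualityMap hpq x) (z - x)) =O[𝓝 x]
      fun z => ‖z - x‖ ^ (p.toReal - 1) * ‖z - x‖ := by
    refine Asymptotics.IsBigO.of_bound cp (Eventually.of_forall fun z => ?_)
    have h2 : penalty z - penalty x - pairingCLM hpq (dualityMap hpq x) (z - x)
        = bregman hpq z x := rfl
    have h3 : ‖z - x‖ ^ (p.toReal - 1) * ‖z - x‖ = ‖x - z‖ ^ p.toReal := by
      rw [norm_sub_rev x z]
      rcases (norm_nonneg (z - x)).eq_or_lt with h | h
      · rw [← h, mul_zero, Real.zero_rpow hpq.pos.ne']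
      · rw [← Real.rpow_add_one h.ne', sub_add_cancel]
    rw [h2, h3, Real.norm_of_nonneg (bregman_nonneg hpq hp2 z x),
      Real.norm_of_nonneg (by positivity)]
    exact hcp.2 x z
  refine h1.trans_isLittleO ?_
  have h4 : Tendsto (fun z : ℓ^p(ℕ, ℝ) => ‖z - x‖ ^ (p.toReal - 1)) (𝓝 x) (𝓝 0) := by
    have h5 : Continuous fun z : ℓ^p(ℕ, ℝ) => ‖z - x‖ ^ (p.toReal - 1) :=
      (Real.continuous_rpow_const (by linarith [hpq.lt])).comp
        (continuous_norm.comp (continuous_id.sub continuous_const))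
    have h6 := h5.tendsto x
    rwa [sub_self, norm_zero, Real.zero_rpow (by linarith [hpq.lt])] at h6
  have h7 := ((Asymptotics.isLittleO_one_iff ℝ).2 h4).mul_isBigO
    (Asymptotics.isBigO_refl (fun z : ℓ^p(ℕ, ℝ) => ‖z - x‖) (𝓝 x))
  simp only [one_mul] at h7
  exact h7.of_norm_right

lemma hasFDerivAt_tikhonov (hp2 : p.toReal ≤ 2) {cp : ℝ} (hcp : IsSmoothnessConstant hpq cp)
    {F : ℓ^p(ℕ, ℝ) → Y} (hF : Differentiable ℝ F) (yδ : Y) (α : ℝ) (x : ℓ^p(ℕ, ℝ)) :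
    HasFDerivAt (tikhonov F yδ α)
      ((innerSL ℝ (F x - yδ)).comp (fderiv ℝ F x)
        + α • pairingCLM hpq (dualityMap hpq x)) x := by
  have h1 := (((hF x).hasFDerivAt.sub_const yδ).norm_sq).const_mul (1 / 2 : ℝ)
  have h2 := (hasFDerivAt_penalty hpq hp2 hcp x).const_mul α
  have h3 := h1.add h2
  have h4 : tikhonov F yδ α = fun z => 1 / 2 * ‖F z - yδ‖ ^ 2 + α * penalty z := by
    funext z
    rw [tikhonov]
    ring
  rw [h4]
  refine h3.congr_fderiv ?_
  ext v
  simp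

lemma pairing_gradTikhonov (hp2 : p.toReal ≤ 2) {cp : ℝ} (hcp : IsSmoothnessConstant hpq cp)
    {F : ℓ^p(ℕ, ℝ) → Y} (hF : Differentiable ℝ F) (yδ : Y) (α : ℝ) (x v : ℓ^p(ℕ, ℝ)) :
    pairing (gradTikhonov hpq F yδ α x) v
      = ⟪F x - yδ, fderiv ℝ F x v⟫ + α * pairing (dualityMap hpq x) v := by
  rw [gradTikhonov, pairing_rieszSeq, (hasFDerivAt_tikhonov hpq hp2 hcp hF yδ α x).fderiv]
  rfl

lemma norm_gradTikhonov_le (hp2 : p.toReal ≤ 2) {cp : ℝ} (hcp : IsSmoothnessConstant hpq cp)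
    {F : ℓ^p(ℕ, ℝ) → Y} (hF : Differentiable ℝ F) (yδ : Y) {α : ℝ} (hα : 0 ≤ α)
    (x : ℓ^p(ℕ, ℝ)) :
    ‖gradTikhonov hpq F yδ α x‖
      ≤ ‖F x - yδ‖ * ‖fderiv ℝ F x‖ + α * ‖x‖ ^ (p.toReal - 1) := by
  refine (norm_rieszSeq_le hpq _).trans ?_
  refine ContinuousLinearMap.opNorm_le_bound _ (by positivity) fun v => ?_
  have h : fderiv ℝ (tikhonov F yδ α) x v
      = ⟪F x - yδ, fderiv ℝ F x v⟫ + α * pairing (dualityMap hpq x) v := by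
    rw [(hasFDerivAt_tikhonov hpq hp2 hcp hF yδ α x).fderiv]
    rfl
  rw [h, Real.norm_eq_abs]
  have h1 := abs_pairing_le hpq (dualityMap hpq x) v
  rw [norm_dualityMap hpq] at h1
  have h2 : |⟪F x - yδ, fderiv ℝ F x v⟫| ≤ ‖F x - yδ‖ * (‖fderiv ℝ F x‖ * ‖v‖) :=
    (abs_real_inner_le_norm _ _).trans
      (mul_le_mul_of_nonneg_left ((fderiv ℝ F x).le_opNorm v) (norm_nonneg _))
  calc |⟪F x - yδ, fderiv ℝ F x v⟫ + α * pairing (dualityMap hpq x) v|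
      ≤ |⟪F x - yδ, fderiv ℝ F x v⟫| + |α * pairing (dualityMap hpq x) v| := abs_add_le _ _
    _ ≤ ‖F x - yδ‖ * (‖fderiv ℝ F x‖ * ‖v‖) + α * (‖x‖ ^ (p.toReal - 1) * ‖v‖) := by
        rw [abs_mul, abs_of_nonneg hα]
        exact add_le_add h2 (mul_le_mul_of_nonneg_left h1 hα)
    _ = _ := by ring

/-- Expansion of the Tikhonov functional with the linearization error of `F` and the Bregman
distance as remainder terms. -/
lemma tikhonov_eq_add_pairing_grad (hp2 : p.toReal ≤ 2) {cp : ℝ}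
    (hcp : IsSmoothnessConstant hpq cp) {F : ℓ^p(ℕ, ℝ) → Y} (hF : Differentiable ℝ F) (yδ : Y)
    (α : ℝ) (z x : ℓ^p(ℕ, ℝ)) :
    tikhonov F yδ α z = tikhonov F yδ α x + pairing (gradTikhonov hpq F yδ α x) (z - x)
      + ⟪F x - yδ, F z - F x - fderiv ℝ F x (z - x)⟫ + ‖F z - F x‖ ^ 2 / 2
      + α * bregman hpq z x := by
  rw [pairing_gradTikhonov hpq hp2 hcp hF, tikhonov, tikhonov, bregman]
  have h : ‖F z - yδ‖ ^ 2
      = ‖F x - yδ‖ ^ 2 + 2 * ⟪F x - yδ, F z - F x⟫ + ‖F z - F x‖ ^ 2 := by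
    rw [← norm_add_sq_real]
    congr 2
    abel
  rw [h, inner_sub_right _ (F z - F x)]
  ring

end Gradient

/-! ### Elementary facts on the constants -/

namespace Constants

variable {C : Constants} {α : ℝ}

lemma Admissible.alphaStar_pos (hC : C.Admissible) : 0 < C.alphaStar :=
  div_pos hC.δ_pos (mul_pos (by linarith [hC.two_lt_s]) hC.ϱ_pos)

lemma Admissible.s_mul_c_mul_ϱ_lt (hC : C.Admissible) : C.s * C.c * C.ϱ < 1 := by
  have h : 0 < C.s * C.c := mul_pos (by linarith [hC.two_lt_s]) hC.c_pos
  have := (lt_div_iff₀ h).1 hC.ϱ_lt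
  linarith

lemma Admissible.γ_pos (hC : C.Admissible) : 0 < C.γ := by
  have := hC.s_mul_c_mul_ϱ_lt
  rw [γ]
  linarith

/-- This is the purpose of `α^*`: it turns `δ + 2 ϱ α` into at most `s ϱ α` in the residual bound.
-/
lemma Admissible.δ_le (hC : C.Admissible) (hα : C.alphaStar ≤ α) :
    C.δ ≤ (C.s - 2) * C.ϱ * α := by
  have := (div_le_iff₀ (mul_pos (by linarith [hC.two_lt_s]) hC.ϱ_pos)).1 hα
  linarith

lemma Admissible.r_pos (hC : C.Admissible) (hα : 0 < α) (hK : 0 ≤ C.K) : 0 < C.r α := by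
  have hγ := hC.γ_pos
  have hc := hC.c_pos
  have hL := hC.L_pos
  have hs : 0 < C.s := by linarith [hC.two_lt_s]
  rw [r]
  split_ifs with h
  · positivity
  · have : 0 < C.K := lt_of_le_of_ne hK (Ne.symm h)
    have : 0 < min (C.γ * α / (C.c * C.s * C.K)) √(C.γ * α / (10 * C.c * C.L)) :=
      lt_min (by positivity) (by positivity)
    positivity

/-- `K + L r_α` bounds `‖F'‖` on the ball of radius `A + r_α`, so this controls `c ‖F x_α - F x‖`
for `x` within `r_α` of `x_α`. The two entries of the minimum give `c K r_α ≤ γ α / s < γ α / 2` and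
`c L r_α² ≤ γ α / 10`. -/
lemma Admissible.c_mul_r_le (hC : C.Admissible) (hα : 0 < α) (hK : 0 ≤ C.K) :
    C.c * ((C.K + C.L * C.r α) * C.r α) ≤ C.γ * α := by
  have hγ := hC.γ_pos
  have hc := hC.c_pos
  have hL := hC.L_pos
  have hs := hC.two_lt_s
  have hr := hC.r_pos hα hK
  have hsq : 2 / (1 + √2) ≤ 1 := by
    rw [div_le_one (by positivity)]
    have : (1 : ℝ) ≤ √2 := Real.one_le_sqrt.2 (by norm_num)
    linarith
  have hle : ∀ m : ℝ, 0 ≤ m → 2 / (1 + √2) * m ≤ m := fun m hm =>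
    mul_le_of_le_one_left hm hsq
  have h1 : C.r α ≤ √(C.γ * α / (10 * C.c * C.L)) := by
    rw [r]
    split_ifs with h
    · exact hle _ (Real.sqrt_nonneg _)
    · have : 0 < C.K := lt_of_le_of_ne hK (Ne.symm h)
      exact (hle _ (le_min (by positivity) (Real.sqrt_nonneg _))).trans (min_le_right _ _)
  have h2 : C.c * C.s * C.K * C.r α ≤ C.γ * α := by
    rcases hK.eq_or_lt with h | h
    · rw [← h, mul_zero, zero_mul]; positivity
    · rw [mul_comm, ← le_div_iff₀ (by positivity), r, if_neg h.ne']
      exact (hle _ (le_min (by positivity) (Real.sqrt_nonneg _))).trans (min_le_left _ _)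
  have h3 : 10 * C.c * C.L * C.r α ^ 2 ≤ C.γ * α := by
    rw [mul_comm, ← le_div_iff₀ (by positivity)]
    exact (Real.le_sqrt hr.le (by positivity)).1 h1
  have h4 : 2 * (C.c * C.K * C.r α) ≤ C.s * (C.c * C.K * C.r α) :=
    mul_le_mul_of_nonneg_right hs.le (by positivity)
  have h5 : 0 < C.γ * α := by positivity
  nlinarith

end Constants

/-! ### A priori bounds -/

section Bounds

variable [Fact (1 ≤ p)] {hpq : p.toReal.HolderConjugate q.toReal} {C : Constants}
  {F : ℓ^p(ℕ, ℝ) → Y} {y yδ : Y} {α : ℝ} {xα : ℓ^p(ℕ, ℝ)}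

/-- Comparison of `Φ_α` at the minimizer and at `0`. -/
lemma norm_minimizer_le {Y : Type*} [NormedAddCommGroup Y] {F : ℓ^p(ℕ, ℝ) → Y} {yδ : Y}
    (hpq : p.toReal.HolderConjugate q.toReal) (hCp : C.p = p.toReal) (hC : C.Admissible) (hα : C.alphaStar ≤ α)
    (h0 : ‖F 0 - yδ‖ = C.res₀) (hmin : ∀ z, tikhonov F yδ α xα ≤ tikhonov F yδ α z) :
    ‖xα‖ ≤ C.A := by
  have hp := hpq.pos
  have ha := hC.alphaStar_pos
  have hres : 0 ≤ C.res₀ := h0 ▸ norm_nonneg _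
  have h1 := hmin 0
  rw [tikhonov, tikhonov, h0, penalty, penalty, norm_zero, Real.zero_rpow hp.ne', zero_div,
    mul_zero, add_zero] at h1
  have h2 : C.alphaStar * (‖xα‖ ^ p.toReal / p.toReal) ≤ C.res₀ ^ 2 / 2 :=
    (mul_le_mul_of_nonneg_right hα (by positivity)).trans
      (by linarith [sq_nonneg ‖F xα - yδ‖])
  have h3 : ‖xα‖ ^ p.toReal ≤ p.toReal / (2 * C.alphaStar) * C.res₀ ^ 2 := by
    have e : ‖xα‖ ^ p.toReal = p.toReal / C.alphaStar *
        (C.alphaStar * (‖xα‖ ^ p.toReal / p.toReal)) := by field_simp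
    rw [e]
    calc _ ≤ p.toReal / C.alphaStar * (C.res₀ ^ 2 / 2) :=
          mul_le_mul_of_nonneg_left h2 (by positivity)
      _ = _ := by field_simp
  have h4 := Real.rpow_le_rpow (by positivity) h3 (by positivity : 0 ≤ 1 / p.toReal)
  rw [← Real.rpow_mul (norm_nonneg _), mul_one_div_cancel hp.ne', Real.rpow_one,
    Real.mul_rpow (by positivity) (by positivity), ← Real.rpow_two, ← Real.rpow_mul hres,
    mul_one_div] at h4
  rwa [Constants.A, hCp]

/-- Comparison with `x†`. The source condition writes the penalty difference as `D(x_α, x†)` plus a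
pairing with `ω`; the pairing costs at most `ϱ (e + δ + c D)`, whose `D` part is absorbed because `ϱ
c ≤ 1`. -/
lemma norm_residual_minimizer_le (hp2 : p.toReal ≤ 2) (hC : C.Admissible)
    (hα : C.alphaStar ≤ α) (hF : StandingAssumption hpq C F y) (hy : ‖y - yδ‖ ≤ C.δ)
    (hmin : ∀ z, tikhonov F yδ α xα ≤ tikhonov F yδ α z) :
    ‖F xα - yδ‖ ≤ C.s * C.ϱ * α := by
  have ha : 0 < α := hC.alphaStar_pos.trans_le hα
  have hϱ := hC.ϱ_pos
  have hc := hC.c_pos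
  have hδ := hC.δ_pos
  obtain ⟨xd, ω, ⟨hxd, -⟩, hω, hsrc⟩ := hF.source
  set D := bregman hpq xα xd with hD
  have hD0 : 0 ≤ D := bregman_nonneg hpq hp2 xα xd
  have hn := hF.nonlinearity xα xd
  rw [hxd] at hn
  set e := ‖F xα - yδ‖ with he
  have h1 := hmin xd
  rw [tikhonov, tikhonov, hxd] at h1
  have h2 : D = penalty xα - penalty xd - ⟪ω, fderiv ℝ F xd (xα - xd)⟫ := by
    rw [← hsrc]; rfl
  have h3 : ‖fderiv ℝ F xd (xα - xd)‖ ≤ e + C.δ + C.c * D := by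
    have e1 : fderiv ℝ F xd (xα - xd)
        = (F xα - yδ) - (y - yδ) - (F xα - y - fderiv ℝ F xd (xα - xd)) := by abel
    rw [e1]
    refine (norm_sub_le _ _).trans (add_le_add ((norm_sub_le _ _).trans ?_) hn)
    linarith
  have h4 : -⟪ω, fderiv ℝ F xd (xα - xd)⟫ ≤ C.ϱ * (e + C.δ + C.c * D) := by
    refine (neg_le_abs _).trans ((abs_real_inner_le_norm _ _).trans ?_)
    exact mul_le_mul hω h3 (norm_nonneg _) hϱ.le
  have h5 : ‖y - yδ‖ ^ 2 ≤ C.δ ^ 2 := by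
    gcongr
  have h6 : C.ϱ * C.c ≤ 1 := by
    have := hC.s_mul_c_mul_ϱ_lt
    nlinarith [mul_pos hϱ hc, hC.two_lt_s]
  have h7 : 0 ≤ α * D * (1 - C.ϱ * C.c) := mul_nonneg (by positivity) (by linarith)
  have h8 : e ^ 2 / 2 ≤ C.δ ^ 2 / 2 + α * (C.ϱ * (e + C.δ)) := by
    nlinarith [mul_le_mul_of_nonneg_left h4 ha.le]
  have h9 : e ≤ C.δ + 2 * (α * C.ϱ) := by
    -- Completing the square in `h8`.
    have h10 : (e - α * C.ϱ) ^ 2 ≤ (C.δ + α * C.ϱ) ^ 2 := by nlinarith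
    have := abs_le_of_sq_le_sq h10 (by positivity)
    linarith [le_abs_self (e - α * C.ϱ)]
  have := hC.δ_le hα
  linarith

lemma norm_fderiv_le (hF : StandingAssumption hpq C F y) (hL : 0 ≤ C.L)
    (hder : ‖fderiv ℝ F 0‖ = C.der₀) {R : ℝ} {x : ℓ^p(ℕ, ℝ)} (hx : ‖x‖ ≤ R) :
    ‖fderiv ℝ F x‖ ≤ C.der₀ + C.L * R := by
  have h := hF.lipschitz x 0
  rw [sub_zero] at h
  calc ‖fderiv ℝ F x‖ = ‖fderiv ℝ F 0 + (fderiv ℝ F x - fderiv ℝ F 0)‖ := by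
        rw [add_sub_cancel]
    _ ≤ ‖fderiv ℝ F 0‖ + ‖fderiv ℝ F x - fderiv ℝ F 0‖ := norm_add_le _ _
    _ ≤ C.der₀ + C.L * R := by
        rw [hder]
        exact add_le_add le_rfl (h.trans (mul_le_mul_of_nonneg_left hx hL))

lemma norm_map_sub_le (hF : StandingAssumption hpq C F y) (hL : 0 ≤ C.L)
    (hder : ‖fderiv ℝ F 0‖ = C.der₀) {R : ℝ} {x z : ℓ^p(ℕ, ℝ)} (hx : ‖x‖ ≤ R) (hz : ‖z‖ ≤ R) :
    ‖F z - F x‖ ≤ (C.der₀ + C.L * R) * ‖z - x‖ :=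
  (convex_closedBall (0 : ℓ^p(ℕ, ℝ)) R).norm_image_sub_le_of_norm_fderiv_le
    (fun w _ => hF.differentiable w)
    (fun w hw => norm_fderiv_le hF hL hder (by simpa using hw))
    (by simpa using hx) (by simpa using hz)

end Bounds

end Tikhonov

/-! ### A dual gradient step -/

section MirrorStep

variable {p q : ℝ≥0∞} {hpq : p.toReal.HolderConjugate q.toReal}

/-- A mirror descent step with step size at most the inverse relative smoothness constant
decreases the objective. -/
lemma bregman_le_of_step (hp2 : p.toReal ≤ 2) {x x' : ℓ^p(ℕ, ℝ)} {g : ℓ^q(ℕ, ℝ)} {t Λ Φ Φ' : ℝ}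
    (ht : 0 ≤ t) (htΛ : t * Λ ≤ 1) (hstep : dualityMap hpq x' = dualityMap hpq x - t • g)
    (hsmooth : Φ' ≤ Φ + pairing g (x' - x) + Λ * bregman hpq x' x) :
    bregman hpq x x' ≤ t * (Φ - Φ') := by
  -- The symmetrized distance equals `t ⟨g, x - x'⟩`; its part `D(x', x)` absorbs the smoothness
  -- remainder `t Λ D(x', x)`.
  have h1 := bregman_add_bregman hpq x x'
  rw [hstep, sub_sub_cancel, pairing_smul_left, pairing_sub_right hpq] at h1
  rw [pairing_sub_right hpq] at hsmooth
  have h2 := mul_le_mul_of_nonneg_left hsmooth ht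
  have h3 := mul_le_mul_of_nonneg_right htΛ (bregman_nonneg hpq hp2 x' x)
  linarith

lemma bregman_step (z : ℓ^p(ℕ, ℝ)) {x x' : ℓ^p(ℕ, ℝ)} {g : ℓ^q(ℕ, ℝ)} {t : ℝ}
    (hstep : dualityMap hpq x' = dualityMap hpq x - t • g) :
    bregman hpq z x' = bregman hpq z x + bregman hpq x x' - t * pairing g (x - z) := by
  rw [bregman_three_point hpq z x x', hstep, sub_sub_cancel, pairing_smul_left,
    pairing_sub_right hpq, pairing_sub_right hpq]
  ring

end MirrorStep

/-! ### Star-convexity and smoothness of the Tikhonov functional relative to the Bregman distance -/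

section Step

variable {p q : ℝ≥0∞} [Fact (1 ≤ p)] {hpq : p.toReal.HolderConjugate q.toReal}
  {Y : Type*} [NormedAddCommGroup Y] [InnerProductSpace ℝ Y]
  {C : Constants} {F : ℓ^p(ℕ, ℝ) → Y} {y yδ : Y} {α cp : ℝ}

/-- If `‖F xα - F x‖` is small, `Φ_α` is strongly star-convex between `x` and `xα` relative to
the Bregman distance. -/
lemma bregman_le_pairing_grad (hp2 : p.toReal ≤ 2) (hcp : IsSmoothnessConstant hpq cp)
    (hF : StandingAssumption hpq C F y) {x xα : ℓ^p(ℕ, ℝ)}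
    (hres : ‖F xα - yδ‖ ≤ C.s * C.ϱ * α) (hΔ : C.c * ‖F xα - F x‖ ≤ C.γ * α) :
    C.γ * α * bregman hpq xα x + (tikhonov F yδ α x - tikhonov F yδ α xα)
      ≤ pairing (gradTikhonov hpq F yδ α x) (x - xα) := by
  have h1 := tikhonov_eq_add_pairing_grad hpq hp2 hcp hF.differentiable yδ α xα x
  have hD := bregman_nonneg hpq hp2 xα x
  have h2 := hF.nonlinearity xα x
  have h3 : ‖F x - yδ‖ ≤ C.s * C.ϱ * α + ‖F xα - F x‖ := by
    have e : F x - yδ = (F xα - yδ) - (F xα - F x) := by abel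
    rw [e]
    exact (norm_sub_le _ _).trans (by linarith)
  have h4 : -((C.s * C.ϱ * α + ‖F xα - F x‖) * (C.c * bregman hpq xα x))
      ≤ ⟪F x - yδ, F xα - F x - fderiv ℝ F x (xα - x)⟫ := by
    refine neg_le_of_abs_le ((abs_real_inner_le_norm _ _).trans ?_)
    exact mul_le_mul h3 h2 (norm_nonneg _) ((norm_nonneg _).trans h3)
  have h5 : C.c * ‖F xα - F x‖ * bregman hpq xα x ≤ C.γ * α * bregman hpq xα x :=
    mul_le_mul_of_nonneg_right hΔ hD
  have h6 : pairing (gradTikhonov hpq F yδ α x) (x - xα)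
      = -pairing (gradTikhonov hpq F yδ α x) (xα - x) := by
    rw [pairing_sub_right hpq, pairing_sub_right hpq, neg_sub]
  -- The surplus is `2 γ α`: one half pays for the change of the residual between `x_α` and `x`, the
  -- other half survives in the conclusion.
  have h7 : α - C.s * C.ϱ * α * C.c = 2 * (C.γ * α) := by rw [Constants.γ]; ring
  have h8 : (α - C.s * C.ϱ * α * C.c) * bregman hpq xα x
      = 2 * (C.γ * α) * bregman hpq xα x := by rw [h7]
  rw [h6]
  nlinarith [sq_nonneg ‖F xα - F x‖]

/-- `Φ_α` is smooth relative to `f_p` on bounded sets. -/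
lemma tikhonov_le_of_lipschitz (hp2 : p.toReal ≤ 2) (hcp : IsSmoothnessConstant hpq cp)
    (hF : StandingAssumption hpq C F y) {x z : ℓ^p(ℕ, ℝ)} {E B κ : ℝ} (hκ : 0 < κ)
    (hE : ‖F x - yδ‖ ≤ E) (hB : ‖F z - F x‖ ≤ B * ‖z - x‖)
    (hconv : κ * ‖z - x‖ ^ 2 ≤ bregman hpq z x) :
    tikhonov F yδ α z ≤ tikhonov F yδ α x + pairing (gradTikhonov hpq F yδ α x) (z - x)
      + (E * C.c + α + B ^ 2 / (2 * κ)) * bregman hpq z x := by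
  rw [tikhonov_eq_add_pairing_grad hpq hp2 hcp hF.differentiable yδ α z x]
  have h1 : ⟪F x - yδ, F z - F x - fderiv ℝ F x (z - x)⟫ ≤ E * (C.c * bregman hpq z x) :=
    (real_inner_le_norm _ _).trans
      (mul_le_mul hE (hF.nonlinearity z x) (norm_nonneg _) ((norm_nonneg _).trans hE))
  have h2 : ‖F z - F x‖ ^ 2 ≤ B ^ 2 * ‖z - x‖ ^ 2 := by
    rw [← mul_pow]
    exact pow_le_pow_left₀ (norm_nonneg _) hB 2
  have h3 : B ^ 2 / 2 * ‖z - x‖ ^ 2 ≤ B ^ 2 / (2 * κ) * bregman hpq z x := by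
    calc B ^ 2 / 2 * ‖z - x‖ ^ 2 = B ^ 2 / (2 * κ) * (κ * ‖z - x‖ ^ 2) := by field_simp
      _ ≤ _ := mul_le_mul_of_nonneg_left hconv (by positivity)
  linarith

/-- A dual step along a direction that is not orthogonal to `x - w` moves `x`. -/
lemma le_bregman_of_step (hp2 : p.toReal ≤ 2) (hcp : IsSmoothnessConstant hpq cp)
    (w : ℓ^p(ℕ, ℝ)) {x x' : ℓ^p(ℕ, ℝ)} {g : ℓ^q(ℕ, ℝ)} {t l : ℝ} (hl : 0 ≤ l)
    (hstep : dualityMap hpq x' = dualityMap hpq x - t • g) :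
    l * (t * pairing g (x - w)) - cp * ‖x - w‖ ^ p.toReal * l ^ p.toReal
      ≤ bregman hpq x x' := by
  -- Nonnegativity of `D(·, x')` is tested at a point moved from `x` towards `w`: the gain is linear
  -- in `l`, the cost `D(x + l (w - x), x)` only of order `l ^ p`.
  have h1 := bregman_step (x + l • (w - x)) hstep
  have h2 := bregman_nonneg hpq hp2 (x + l • (w - x)) x'
  have h3 := hcp.2 x (x + l • (w - x))
  rw [sub_add_cancel_left, norm_neg, norm_smul, Real.norm_of_nonneg hl, norm_sub_rev w x,
    Real.mul_rpow hl (norm_nonneg _)] at h3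
  have h4 : x - (x + l • (w - x)) = l • (x - w) := by
    rw [sub_add_cancel_left, ← smul_neg, neg_sub]
  rw [h4, pairing_smul_right] at h1
  linarith

end Step

/-! ### Auxiliary facts on real numbers and sequences -/

lemma exists_mul_sub_rpow_pos {r a b : ℝ} (hr : 1 < r) (ha : 0 < a) (hb : 0 ≤ b) :
    ∃ l : ℝ, 0 < l ∧ 0 < l * a - b * l ^ r := by
  -- `l` is chosen with `l ^ (r - 1) = u` and `b u < a`; the shift `b + 1` covers `b = 0`.
  set u := a / (2 * (b + 1)) with hu
  have hu0 : 0 < u := by positivity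
  set l := u ^ (1 / (r - 1)) with hl
  have hl0 : 0 < l := by positivity
  have h1 : l ^ r = u * l := by
    have h2 : l ^ (r - 1) = u := by
      rw [hl, ← Real.rpow_mul hu0.le, one_div_mul_cancel (by linarith), Real.rpow_one]
    rw [← h2, ← Real.rpow_add_one hl0.ne', sub_add_cancel]
  refine ⟨l, hl0, ?_⟩
  have h3 : b * u < a := by
    rw [hu, mul_div_assoc', div_lt_iff₀ (by positivity)]
    nlinarith
  rw [h1]
  nlinarith [mul_pos hl0 (sub_pos.2 h3)]

/-- A nonnegative sequence with `a (k+1) ≤ (1 - μ β k) a k` tends to zero if the factors `β k`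
are bounded below as long as `a k` is. -/
lemma tendsto_zero_of_le_sub_mul {a β : ℕ → ℝ} {μ : ℝ} (hμ : 0 < μ) (ha : ∀ k, 0 ≤ a k)
    (hβ : ∀ k, 0 ≤ β k) (hdec : ∀ k, a (k + 1) ≤ a k - β k * (μ * a k))
    (hlow : ∀ ε, 0 < ε → ∃ b, 0 < b ∧ ∀ k, ε ≤ a k → b ≤ β k) :
    Tendsto a atTop (𝓝 0) := by
  have hanti : Antitone a := antitone_nat_of_succ_le fun k => by
    have := hdec k
    have := mul_nonneg (hβ k) (mul_nonneg hμ.le (ha k))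
    linarith
  rw [Metric.tendsto_atTop]
  intro ε hε
  obtain ⟨b, hb, hlow⟩ := hlow ε hε
  obtain ⟨N, hN⟩ : ∃ N, a N < ε := by
    by_contra! h
    have hlin : ∀ k : ℕ, a k ≤ a 0 - k * (b * (μ * ε)) := by
      intro k
      induction k with
      | zero => simp
      | succ k ih =>
        have h1 : b * (μ * ε) ≤ β k * (μ * a k) :=
          mul_le_mul (hlow k (h k)) (mul_le_mul_of_nonneg_left (h k) hμ.le) (by positivity)
            (hβ k)
        have := hdec k
        push_cast
        linarith
    obtain ⟨k, hk⟩ := exists_nat_gt (a 0 / (b * (μ * ε)))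
    rw [div_lt_iff₀ (by positivity)] at hk
    linarith [hlin k, ha k]
  refine ⟨N, fun n hn => ?_⟩
  rw [Real.dist_eq, sub_zero, abs_of_nonneg (ha n)]
  exact (hanti hn).trans_lt hN

/-! ### Step sizes, line search values and a priori bounds for one step -/

namespace Constants

variable {C : Constants} {α : ℝ}

lemma Admissible.cBarA_pos (hC : C.Admissible) (hp : 1 < C.p) (hα : 0 < α) (hK : 0 ≤ C.K)
    (hA : 0 ≤ C.A) : 0 < C.cBarA α := by
  have hr := hC.r_pos hα hK
  have : 0 < C.p - 1 := by linarith
  rw [cBarA]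
  positivity

/-- `c̄` stays away from zero as long as the attainable decrease does. -/
lemma Admissible.exists_le_cBar (hC : C.Admissible) (hp : 1 < C.p) (hα : 0 < α) (hK : 0 ≤ C.K)
    (hA : 0 ≤ C.A) {cp : ℝ} (hcp : 0 < cp) :
    ∃ ν : ℝ, 0 < ν ∧ ∀ g, C.cBar α cp g = min 1 (ν * g) := by
  have hr := hC.r_pos hα hK
  have hcA := hC.cBarA_pos hp hα hK hA
  have hs : 0 < C.s := by linarith [hC.two_lt_s]
  have hL := hC.L_pos
  have hϱ := hC.ϱ_pos
  refine ⟨8 * C.cBarA α / (4 * C.K ^ 2 + 4 * C.L * C.s * C.ϱ * α + 4 * C.L * C.K * C.r α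
    + C.L ^ 2 * C.r α ^ 2 + 8 * α * cp * C.cBarA α ^ ((2 - C.p) / 2)), by positivity, fun g => ?_⟩
  rw [cBar, div_mul_eq_mul_div]

end Constants

section StepSizeBounds

variable {p q : ℝ≥0∞} [Fact (1 ≤ p)] (hpq : p.toReal.HolderConjugate q.toReal)
  {Y : Type*} [NormedAddCommGroup Y]
  {F : ℓ^p(ℕ, ℝ) → Y} {yδ : Y} {α : ℝ} {xα : ℓ^p(ℕ, ℝ)}

/-- The global minimum bounds the values on the curve from below, so the real `sInf` is a genuine
infimum. -/
lemma lineMin_le (hmin : ∀ z, tikhonov F yδ α xα ≤ tikhonov F yδ α z) (x : ℓ^p(ℕ, ℝ)) {t : ℝ}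
    (ht : 0 ≤ t) :
    lineMin hpq F yδ α x ≤ tikhonov F yδ α
      (dualityMap hpq.symm (dualityMap hpq x - t • gradTikhonov hpq F yδ α x)) := by
  refine csInf_le ⟨tikhonov F yδ α xα, ?_⟩ ⟨t, ht, rfl⟩
  rintro _ ⟨s, -, rfl⟩
  exact hmin _

lemma lineMin_le_self (hmin : ∀ z, tikhonov F yδ α xα ≤ tikhonov F yδ α z) (x : ℓ^p(ℕ, ℝ)) :
    lineMin hpq F yδ α x ≤ tikhonov F yδ α x := by
  have h := lineMin_le hpq hmin x le_rfl
  rwa [zero_smul, sub_zero, dualityMap_dualityMap] at h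

end StepSizeBounds

/-- This avoids a circle: the smoothness constant requires a norm bound on the new point before that
point is known to lie in the Bregman ball. The bound comes from `‖J_q ξ‖ = ‖ξ‖ ^ (q - 1)`. -/
lemma norm_le_of_dualityMap_eq {p q : ℝ≥0∞} (hpq : p.toReal.HolderConjugate q.toReal)
    {x x' : ℓ^p(ℕ, ℝ)} {g : ℓ^q(ℕ, ℝ)} {t R G : ℝ} (ht : 0 ≤ t) (ht1 : t ≤ 1)
    (hx : ‖x‖ ≤ R) (hg : ‖g‖ ≤ G) (hstep : dualityMap hpq x' = dualityMap hpq x - t • g) :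
    ‖x'‖ ≤ (R ^ (p.toReal - 1) + G) ^ (q.toReal - 1) := by
  have hq : 1 < q.toReal := hpq.symm.lt
  have : Fact (1 ≤ q) := ⟨by
    by_contra! h
    have := ENNReal.toReal_mono ENNReal.one_ne_top h.le
    rw [ENNReal.toReal_one] at this
    linarith⟩
  have h1 : ‖dualityMap hpq x'‖ ≤ R ^ (p.toReal - 1) + G := by
    rw [hstep]
    refine (norm_sub_le _ _).trans (add_le_add ?_ ?_)
    · have h := norm_dualityMap hpq x
      have h2 : ‖x‖ ^ (p.toReal - 1) ≤ R ^ (p.toReal - 1) :=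
        Real.rpow_le_rpow (lp.norm_nonneg' x) hx (by linarith [hpq.lt])
      exact h.le.trans h2
    · rw [norm_smul, Real.norm_of_nonneg ht]
      exact (mul_le_of_le_one_left (norm_nonneg _) ht1).trans hg
  have h3 := norm_dualityMap hpq.symm (dualityMap hpq x')
  rw [dualityMap_dualityMap] at h3
  rw [h3]
  exact Real.rpow_le_rpow (lp.norm_nonneg' _) h1 (by linarith)

end DualTigra

/-- `M₀` depends only on the numbers collected in `C`, on `α` and on `d`.  The radius `d` is any
positive number for which the Bregman ball of radius `d` around the minimizer `xα` lies in the
norm ball of radius `r_α`, and `cp` is any admissible constant in `D_{f_p}(z, x) ≤ cp ‖x - z‖^p`. -/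
theorem theorem3p7 {p q : ℝ≥0∞} [Fact (1 ≤ p)] (hpq : p.toReal.HolderConjugate q.toReal)
    (hp2 : p ≤ 2) (C : Constants) (hCp : C.p = p.toReal) (hC : C.Admissible)
    (α : ℝ) (hα : C.alphaStar ≤ α) (d : ℝ) (hd : 0 < d) :
    ∃ M₀ : ℝ, 0 < M₀ ∧ ∀ M : ℝ, M₀ ≤ M →
      ∀ (Y : Type*) [NormedAddCommGroup Y] [InnerProductSpace ℝ Y] [CompleteSpace Y]
        (F : ℓ^p(ℕ, ℝ) → Y) (y yδ : Y),
        StandingAssumption hpq C F y → ‖y - yδ‖ ≤ C.δ →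
        ‖F 0 - yδ‖ = C.res₀ → ‖fderiv ℝ F 0‖ = C.der₀ →
      ∀ xα : ℓ^p(ℕ, ℝ), (∀ z, tikhonov F yδ α xα ≤ tikhonov F yδ α z) →
        bregmanBall hpq xα d ⊆ Metric.closedBall xα (C.r α) →
      ∀ cp : ℝ, IsSmoothnessConstant hpq cp →
      ∀ x : ℕ → ℓ^p(ℕ, ℝ), x 0 ∈ bregmanBall hpq xα d →
        IsDualGradientSequence hpq C F yδ α cp M x →
        Tendsto x atTop (𝓝 xα) := by
  have hp2' : p.toReal ≤ 2 := by
    simpa using ENNReal.toReal_mono (by norm_num) hp2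
  have hα0 : 0 < α := hC.alphaStar_pos.trans_le hα
  have hc := hC.c_pos
  have hL := hC.L_pos
  have hγ := hC.γ_pos
  -- On the Bregman ball, `R₁` bounds the norm, `E` the residual and `G` the gradient. `R` also
  -- bounds every point reached from there by a dual step of size at most `1`; `κ`, `B` and `Λ` are
  -- the convexity, Lipschitz and relative smoothness constants for radius `R`. All are fixed before
  -- `F` and the data, as uniformity of `M₀` demands.
  set R₁ := C.A + C.r α with hR₁
  set E := C.s * C.ϱ * α + C.γ * α / C.c with hE
  set G := E * (C.der₀ + C.L * R₁) + α * R₁ ^ (p.toReal - 1) with hG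
  set R := max R₁ ((R₁ ^ (p.toReal - 1) + G) ^ (q.toReal - 1)) with hR
  obtain ⟨κ, hκ, hconv⟩ := exists_mul_sq_norm_sub_le_bregman hpq hp2' R
  set B := C.der₀ + C.L * R with hB
  set Λ := E * C.c + α + B ^ 2 / (2 * κ) with hΛ
  -- With `β_k ≤ 1 / (2 M)`, the entry `1` gives `β_k ≤ 1`, as needed for `R`, and `Λ` gives `β_k Λ
  -- ≤ 1`.
  refine ⟨max 1 Λ, lt_max_of_lt_left one_pos, ?_⟩
  intro M hM Y _ _ _ F y yδ hF hy hres hder xα hmin hball cp hcp x hx0 hx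
  have hM1 : 1 ≤ M := (le_max_left _ _).trans hM
  have hMΛ : Λ ≤ M := (le_max_right _ _).trans hM
  have hxα := norm_minimizer_le hpq hCp hC hα hres hmin
  have hA : 0 ≤ C.A := (norm_nonneg _).trans hxα
  have hder0 : 0 ≤ C.der₀ := hder ▸ norm_nonneg _
  have hK : 0 ≤ C.K := by rw [Constants.K]; positivity
  have hr := hC.r_pos hα0 hK
  have hs : 0 < C.s := by linarith [hC.two_lt_s]
  have hϱ := hC.ϱ_pos
  have hE0 : 0 < E := by positivity
  have hG0 : 0 < G := by positivity
  have hΛ0 : 0 < Λ := by positivity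
  have hresα := norm_residual_minimizer_le hp2' hC hα hF hy hmin
  have hKr : C.der₀ + C.L * R₁ = C.K + C.L * C.r α := by rw [hR₁, Constants.K]; ring
  have hR₁R : R₁ ≤ R := le_max_left _ _
  have hnorm : ∀ z, bregman hpq xα z ≤ d → ‖z - xα‖ ≤ C.r α ∧ ‖z‖ ≤ R₁ := by
    intro z hz
    have h1 : ‖z - xα‖ ≤ C.r α := by simpa [dist_eq_norm] using hball hz
    refine ⟨h1, ?_⟩
    calc ‖z‖ = ‖xα + (z - xα)‖ := by rw [add_sub_cancel]
      _ ≤ R₁ := (norm_add_le _ _).trans (add_le_add hxα h1)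
  have hΔ : ∀ z, bregman hpq xα z ≤ d → C.c * ‖F xα - F z‖ ≤ C.γ * α := by
    intro z hz
    obtain ⟨h1, h2⟩ := hnorm z hz
    have h3 := norm_map_sub_le hF hL.le hder h2 (by linarith : ‖xα‖ ≤ R₁)
    rw [hKr, norm_sub_rev xα z] at h3
    refine (mul_le_mul_of_nonneg_left (h3.trans ?_) hc.le).trans (hC.c_mul_r_le hα0 hK)
    exact mul_le_mul_of_nonneg_left h1 (by positivity)
  have hEz : ∀ z, bregman hpq xα z ≤ d → ‖F z - yδ‖ ≤ E := by
    intro z hz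
    have e : F z - yδ = (F xα - yδ) - (F xα - F z) := by abel
    rw [e]
    refine (norm_sub_le _ _).trans (add_le_add hresα ?_)
    rw [le_div_iff₀ hc, mul_comm]
    exact hΔ z hz
  have hGz : ∀ z, bregman hpq xα z ≤ d → ‖gradTikhonov hpq F yδ α z‖ ≤ G := by
    intro z hz
    obtain ⟨-, h2⟩ := hnorm z hz
    refine (norm_gradTikhonov_le hpq hp2' hcp hF.differentiable yδ hα0.le z).trans
      (add_le_add ?_ ?_)
    · exact mul_le_mul (hEz z hz) (norm_fderiv_le hF hL.le hder h2) (norm_nonneg _) hE0.le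
    · exact mul_le_mul_of_nonneg_left
        (Real.rpow_le_rpow (norm_nonneg _) h2 (by linarith [hpq.lt])) hα0.le
  have hstar : ∀ z, bregman hpq xα z ≤ d →
      C.γ * α * bregman hpq xα z + (tikhonov F yδ α z - tikhonov F yδ α xα)
        ≤ pairing (gradTikhonov hpq F yδ α z) (z - xα) := fun z hz =>
    bregman_le_pairing_grad hp2' hcp hF hresα (hΔ z hz)
  have hdescent : ∀ z z' t, bregman hpq xα z ≤ d → 0 ≤ t → t ≤ 1 → t * Λ ≤ 1 →
      dualityMap hpq z' = dualityMap hpq z - t • gradTikhonov hpq F yδ α z →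
      bregman hpq z z' ≤ t * (tikhonov F yδ α z - tikhonov F yδ α z') := by
    intro z z' t hz ht ht1 htΛ hstep
    obtain ⟨-, h2⟩ := hnorm z hz
    have hzR := h2.trans hR₁R
    have hzR' : ‖z'‖ ≤ R := (norm_le_of_dualityMap_eq hpq ht ht1 h2 (hGz z hz) hstep).trans
      (le_max_right _ _)
    exact bregman_le_of_step hp2' ht htΛ hstep
      (tikhonov_le_of_lipschitz hp2' hcp hF hκ (hEz z hz)
        (norm_map_sub_le hF hL.le hder hzR hzR') (hconv z' z hzR' hzR))
  set β : ℕ → ℝ := fun k => stepSize hpq C F yδ α cp M (x k) with hβ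
  obtain ⟨ν, hν, hcBar⟩ := hC.exists_le_cBar (hCp ▸ hpq.lt) hα0 hK hA hcp.1
  have hβ0 : ∀ k, 0 ≤ β k := by
    intro k
    have h1 := sub_nonneg.2 (lineMin_le_self hpq hmin (x k))
    rw [hβ]
    simp only [stepSize, hcBar]
    have : 0 ≤ min 1 (ν * (tikhonov F yδ α (x k) - lineMin hpq F yδ α (x k))) :=
      le_min zero_le_one (by positivity)
    exact le_min (by positivity) (by positivity)
  have hβM : ∀ k, β k ≤ 1 / (2 * M) := fun k => min_le_right _ _
  have hβ1 : ∀ k, β k ≤ 1 := fun k => (hβM k).trans (by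
    rw [div_le_one (by positivity)]; linarith)
  have hβΛ : ∀ k, β k * Λ ≤ 1 := fun k => by
    refine (mul_le_mul (hβM k) hMΛ hΛ0.le (by positivity)).trans ?_
    have : M ≠ 0 := by linarith
    field_simp
    norm_num
  -- The term `D(x_k, x_{k+1}) ≤ β_k (Φ(x_k) - Φ(x_{k+1}))` is cancelled by the functional gap in
  -- `hstar`, since `Φ(x_{k+1}) ≥ Φ(x_α)`.
  have hmono : ∀ k, bregman hpq xα (x k) ≤ d →
      bregman hpq xα (x (k + 1))
        ≤ bregman hpq xα (x k) - β k * (C.γ * α * bregman hpq xα (x k)) := by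
    intro k hk
    have h1 := hdescent _ _ _ hk (hβ0 k) (hβ1 k) (hβΛ k) (hx k)
    have h2 := bregman_step xα (hx k)
    have h3 := mul_le_mul_of_nonneg_left (hstar _ hk) (hβ0 k)
    have h4 := mul_le_mul_of_nonneg_left (hmin (x (k + 1))) (hβ0 k)
    simp only [hβ] at h1 h2 h3 h4 ⊢
    linarith
  have hmem : ∀ k, bregman hpq xα (x k) ≤ d := by
    intro k
    induction k with
    | zero => exact hx0
    | succ k ih =>
      have h1 := hmono k ih
      have h2 := bregman_nonneg hpq hp2' xα (x k)
      have h3 : 0 ≤ β k * (C.γ * α * bregman hpq xα (x k)) :=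
        mul_nonneg (hβ0 k) (by positivity)
      linarith
  have hlim : Tendsto (fun k => bregman hpq xα (x k)) atTop (𝓝 0) := by
    refine tendsto_zero_of_le_sub_mul (mul_pos hγ hα0)
      (fun k => bregman_nonneg hpq hp2' xα (x k)) hβ0 (fun k => hmono k (hmem k)) ?_
    intro ε hε
    -- A trial step size independent of `k`, used only to bound `φ_k` from above. The step moves
    -- `x_k` by Bregman distance at least `η`, so `Φ` drops by at least `η / t`.
    set t := 1 / (1 + Λ) with ht
    have ht0 : 0 < t := by positivity
    have ht1 : t ≤ 1 := by rw [ht, div_le_one (by positivity)]; linarith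
    have htΛ : t * Λ ≤ 1 := by
      rw [ht, one_div_mul_eq_div, div_le_one (by positivity)]; linarith
    obtain ⟨l, hl, hpos⟩ := exists_mul_sub_rpow_pos (r := p.toReal)
      (a := t * (C.γ * α * ε)) (b := cp * C.r α ^ p.toReal) hpq.lt (by positivity)
      (mul_nonneg hcp.1.le (by positivity))
    set η := l * (t * (C.γ * α * ε)) - cp * C.r α ^ p.toReal * l ^ p.toReal with hη
    have hgap : ∀ k, ε ≤ bregman hpq xα (x k) →
        η / t ≤ tikhonov F yδ α (x k) - lineMin hpq F yδ α (x k) := by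
      intro k hk
      set ξ := dualityMap hpq (x k) - t • gradTikhonov hpq F yδ α (x k) with hξ
      have hstep : dualityMap hpq (dualityMap hpq.symm ξ)
          = dualityMap hpq (x k) - t • gradTikhonov hpq F yδ α (x k) :=
        dualityMap_dualityMap hpq.symm ξ
      have h1 := hdescent _ _ _ (hmem k) ht0.le ht1 htΛ hstep
      have h2 := le_bregman_of_step hp2' hcp xα hl.le hstep
      have h3 := lineMin_le hpq hmin (x k) ht0.le
      have h4 : C.γ * α * ε ≤ pairing (gradTikhonov hpq F yδ α (x k)) (x k - xα) := by
        have := mul_le_mul_of_nonneg_left hk (mul_pos hγ hα0).le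
        have := hstar _ (hmem k)
        have := hmin (x k)
        linarith
      have h5 : ‖x k - xα‖ ^ p.toReal ≤ C.r α ^ p.toReal :=
        Real.rpow_le_rpow (norm_nonneg _) (hnorm _ (hmem k)).1 hpq.nonneg
      have h6 := mul_le_mul_of_nonneg_left (mul_le_mul_of_nonneg_left h4 ht0.le) hl.le
      have h7 := mul_le_mul_of_nonneg_right (mul_le_mul_of_nonneg_left h5 hcp.1.le)
        (Real.rpow_nonneg hl.le p.toReal)
      have h8 := mul_le_mul_of_nonneg_left h3 ht0.le
      rw [div_le_iff₀ ht0]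
      linarith
    refine ⟨min (C.γ * min 1 (ν * (η / t)) * α / G ^ 2) (1 / (2 * M)), ?_, fun k hk => ?_⟩
    · have : 0 < min 1 (ν * (η / t)) := lt_min one_pos (by positivity)
      exact lt_min (by positivity) (by positivity)
    · rw [hβ]
      simp only [stepSize, hcBar]
      refine min_le_min_right _ ?_
      -- At a zero gradient the quotient in the step size would be `0`. Star-convexity excludes this
      -- while `D(x_α, x_k) ≥ ε`.
      have hg : 0 < ‖gradTikhonov hpq F yδ α (x k)‖ := by
        have h1 := hstar _ (hmem k)
        have h2 := mul_le_mul_of_nonneg_left hk (mul_pos hγ hα0).le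
        have h3 := hmin (x k)
        have h4 : 0 < C.γ * α * ε := by positivity
        have h5 := (le_abs_self _).trans
          (abs_pairing_le hpq (gradTikhonov hpq F yδ α (x k)) (x k - xα))
        by_contra! h
        have h6 := mul_nonpos_of_nonpos_of_nonneg h (norm_nonneg (x k - xα))
        linarith
      have h1 : min 1 (ν * (η / t))
          ≤ min 1 (ν * (tikhonov F yδ α (x k) - lineMin hpq F yδ α (x k))) :=
        min_le_min_left _ (mul_le_mul_of_nonneg_left (hgap k hk) hν.le)
      have h0 : 0 < min 1 (ν * (η / t)) := lt_min one_pos (by positivity)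
      refine div_le_div₀ ?_ ?_ (by positivity) ?_
      · have := h0.le.trans h1
        positivity
      · gcongr
      · exact pow_le_pow_left₀ hg.le (hGz _ (hmem k)) 2
  rw [tendsto_iff_norm_sub_tendsto_zero]
  have hsq : Tendsto (fun k => ‖x k - xα‖ ^ 2) atTop (𝓝 0) := by
    have h1 := hlim.div_const κ
    rw [zero_div] at h1
    refine squeeze_zero (fun k => by positivity) (fun k => ?_) h1
    rw [le_div_iff₀ hκ, norm_sub_rev, mul_comm]
    exact hconv xα (x k) (by linarith) ((hnorm _ (hmem k)).2.trans hR₁R)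
  have h2 := (Real.continuous_sqrt.tendsto 0).comp hsq
  simpa [Function.comp_def, Real.sqrt_sq (norm_nonneg _)] using h2
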